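/- Identify $\mathbb C$ with $\mathbb R^2$ and $\mathbb Z[i]$ with $\mathbb Z^2$, and put $\|x\|_\infty=\max\{|\mathrm{Re}\,x|,|\mathrm{Im}\,x|\}$. Let $U=\{x\in\mathbb C:-\frac12\le\mathrm{Re}\,x<\frac12,\ -\frac12\le\mathrm{Im}\,x<\frac12\}$. For $z\in\mathbb C$ let $\lfloor z\rceil$ denote the Gaussian integer with $z-\lfloor z\rceil\in U$. For $x\in U\setminus\mathbb Q^2$ let $c_n(x)=\lfloor 1/T^{n-1}(x)\rceil$ $(n\ge1)$, where $T(x)=1/x-\lfloor 1/x\rceil$; these are the partial quotients of the Hurwitz continued fraction expansion of $x$. Let $$E=\{x\in U\setminus\mathbb Q^2: c_m(x)\ne c_n(x)\text{ whenever }m\ne n\},$$ let $H$ be the set of $x\in E$ such that, for every nonempty finite $A\subset\mathbb Z^2$, the set $\{c_n(x):n\ge1\}$ contains infinitely many homothetic copies $v+mA$ ($v\in\mathbb Z^2$, $m\ge1$ an integer) of $A$, and let $$S=\{x\in U\setminus\mathbb Q^2: 3^n\le\|c_n(x)\|_\infty<2\cdot3^n\text{ for all }n\ge1\}.$$ Let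 $\varepsilon>0$. Then the following hold. (1) There is a strictly increasing sequence $(n_k)_{k\ge1}$ of positive integers such that $$3^{n_k+1}>2\cdot3^{n_k}+\sqrt{2\varepsilon n_k}\quad\text{and}\quad \sum_{j=1}^k\varepsilon n_j(n_j+2)\le2\varepsilon n_k^2\quad\text{for all }k\ge1,$$ $$\prod_{j=1}^{n+1}\frac1{\sqrt2\,3^{j+1}}\cdot\frac1{3^{2\varepsilon n^2}}\ \ge\ \Bigl(\prod_{j=1}^n\frac1{3^{2(j-1)}}\Bigr)^{1+5\varepsilon}\quad\text{for all }n\ge n_1 .$$ (2) Let $(n_k)$ be any such sequence. For $k\ge1$ let $$W_k=\{2\cdot3^{n_k}+2\cdot3^{n_k}i+z:\ z\in\mathbb Z[i],\ \mathrm{Re}\,z\ge0,\ \mathrm{Im}\,z\ge0,\ \|z\|_\infty\le\sqrt{\varepsilon n_k}-1\},$$ which is a finite set, and let $w^{(k)}_1,\dots,w^{(k)}_{\#W_k}$ be any enumeration of $W_k$ without repetition. For each $y\in S$ there is exactly one point $x(y)\in U\setminus\mathbb Q^2$ whose sequence of partial quotients is obtained from $(c_n(y))_{n\ge1}$ by inserting,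 for every $k\ge1$, the block $w^{(k)}_1,\dots,w^{(k)}_{\#W_k}$ between $c_{n_k}(y)$ and $c_{n_k+1}(y)$. Put $\widetilde S=\{x(y):y\in S\}$. The map $y\in S\mapsto x(y)\in\widetilde S$ is a bijection; let $f:\widetilde S\to S$ be its inverse, which deletes the inserted partial quotients. Then there is $C>0$ such that $$|f(x_1)-f(x_2)|\le C\,|x_1-x_2|^{\frac1{1+5\varepsilon}}\quad\text{for all }x_1,x_2\in\widetilde S .$$ Moreover $\widetilde S\subset H$ and $\dim_{\rm H}\widetilde S\ge\frac1{1+5\varepsilon}$. (3) Consequently $\dim_{\rm H}H\ge\frac{1}{1+5\varepsilon}$. -/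

import Mathlib

namespace Hurwitz

/-- The half-open unit square `U` centred at the origin. -/
def unitSquare : Set ℂ :=
  {x | -(1 / 2) ≤ x.re ∧ x.re < 1 / 2 ∧ -(1 / 2) ≤ x.im ∧ x.im < 1 / 2}

/-- `U ∖ ℚ²`, where `ℂ` is identified with `ℝ²`: the complex irrationals of `U`. -/
def irrationals : Set ℂ :=
  {x | x ∈ unitSquare ∧ ¬ ((∃ q : ℚ, x.re = q) ∧ (∃ q : ℚ, x.im = q))}

/-- The nearest Gaussian integer: `z - round z` lies in the half-open square `U`. -/
noncomputable def round (z : ℂ) : GaussianInt := ⟨⌊z.re + 1 / 2⌋, ⌊z.im + 1 / 2⌋⟩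

/-- The Hurwitz map `x ↦ 1 / x - round (1 / x)`. -/
noncomputable def hurwitzMap (x : ℂ) : ℂ := x⁻¹ - (round x⁻¹ : ℂ)

/-- The partial quotients of the Hurwitz continued fraction expansion
`x = 1 / (c₁ + 1 / (c₂ + ⋯))`, counted from `0`: `digits x n` is `cₙ₊₁(x)`.
No iterate vanishes when `x` is in `irrationals`. -/
noncomputable def digits (x : ℂ) (n : ℕ) : GaussianInt := round (hurwitzMap^[n] x)⁻¹

/-- The maximum norm of a Gaussian integer. -/
def supNorm (z : GaussianInt) : ℤ := max |z.re| |z.im|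

/-- The set `E` of irrationals whose partial quotients are pairwise distinct. -/
def distinctDigits : Set ℂ := {x | x ∈ irrationals ∧ Function.Injective (digits x)}

/-- `B = v + m A` for some Gaussian integer `v` and some integer `m ≥ 1`. -/
def IsHomotheticCopy (A B : Set GaussianInt) : Prop :=
  ∃ (v : GaussianInt) (m : ℕ), 1 ≤ m ∧ B = (fun a => v + m • a) '' A

/-- The set `H` of those `x ∈ E` whose set of partial quotients contains infinitely many
homothetic copies of every nonempty finite set of Gaussian integers. (The empty set has
only one homothetic copy, itself.) -/
def patternSet : Set ℂ :=
  {x | x ∈ distinctDigits ∧ ∀ A : Set GaussianInt, A.Finite → A.Nonempty →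
    {B : Set GaussianInt | IsHomotheticCopy A B ∧ B ⊆ Set.range (digits x)}.Infinite}

/-- The seed set `S`: `3ⁿ ≤ ‖cₙ(x)‖∞ < 2 · 3ⁿ` for all `n ≥ 1`. -/
def seedSet : Set ℂ :=
  {x | x ∈ irrationals ∧
    ∀ n : ℕ, 3 ^ (n + 1) ≤ supNorm (digits x n) ∧ supNorm (digits x n) < 2 * 3 ^ (n + 1)}

/-- The conditions on the insertion positions `n₁ < n₂ < ⋯`, counted from `0`:
`n k` is `nₖ₊₁`. -/
structure IsAdmissible (ε : ℝ) (n : ℕ → ℕ) : Prop where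
  pos : ∀ k, 0 < n k
  strictMono : StrictMono n
  gap : ∀ k, (3 : ℝ) ^ (n k + 1) > 2 * 3 ^ n k + √(2 * ε * n k)
  sum_le : ∀ k, ∑ j ∈ Finset.range (k + 1), ε * n j * (n j + 2) ≤ 2 * ε * (n k : ℝ) ^ 2
  prod_ge : ∀ N : ℕ, n 0 ≤ N →
    (∏ j ∈ Finset.Icc 1 (N + 1), 1 / (√2 * 3 ^ (j + 1))) * (1 / (3 : ℝ) ^ (2 * ε * (N : ℝ) ^ 2))
      ≥ (∏ j ∈ Finset.Icc 1 N, 1 / (3 : ℝ) ^ (2 * (j - 1))) ^ (1 + 5 * ε)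

/-- The square of Gaussian integers `2·3ᵐ + 2·3ᵐ i + z` with `Re z, Im z ≥ 0` and
`‖z‖∞ ≤ √(ε m) - 1`; the square `Wₖ` is `square ε nₖ`. -/
def square (ε : ℝ) (m : ℕ) : Set GaussianInt :=
  {u | ∃ z : GaussianInt, 0 ≤ z.re ∧ 0 ≤ z.im ∧ (supNorm z : ℝ) ≤ √(ε * m) - 1 ∧
    u = ⟨2 * 3 ^ m, 2 * 3 ^ m⟩ + z}

/-- `w k` lists the elements of the square at position `n k`, each exactly once. -/
def IsEnumeration (ε : ℝ) (n : ℕ → ℕ) (w : ℕ → List GaussianInt) : Prop :=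
  ∀ k, (w k).Nodup ∧ ∀ u, u ∈ w k ↔ u ∈ square ε (n k)

/-- The block inserted right after the `j`-th term (`j ≥ 1`): it is `w k` if `j = n k`, and empty
if `j` is not a value of `n`. (When `n` is strictly increasing and positive, `j = n k` forces
`k < j`.) -/
def block (n : ℕ → ℕ) (w : ℕ → List GaussianInt) (j : ℕ) : List GaussianInt :=
  (List.range j).flatMap fun k => if n k = j then w k else []

/-- The first `M` terms of the sequence `a`, with the blocks inserted. -/
def insertPrefix (n : ℕ → ℕ) (w : ℕ → List GaussianInt) (a : ℕ → GaussianInt) (M : ℕ) :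
    List GaussianInt :=
  (List.range M).flatMap fun j => a j :: block n w (j + 1)

theorem le_length_insertPrefix (n : ℕ → ℕ) (w : ℕ → List GaussianInt) (a : ℕ → GaussianInt)
    (M : ℕ) : M ≤ (insertPrefix n w a M).length := by
  induction M with
  | zero => simp
  | succ M ih =>
    have h : insertPrefix n w a (M + 1)
        = insertPrefix n w a M ++ (a M :: block n w (M + 1)) := by
      simp [insertPrefix, List.range_succ]
    rw [h, List.length_append, List.length_cons]
    omega

/-- The sequence obtained from `a` by inserting, for every `k`, the block `w k` after the
`n k`-th term of `a`. -/
def insertBlocks (n : ℕ → ℕ) (w : ℕ → List GaussianInt) (a : ℕ → GaussianInt) (m : ℕ) :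
    GaussianInt :=
  (insertPrefix n w a (m + 1))[m]'(le_length_insertPrefix n w a (m + 1))

/-- The point `x(y)` of `irrationals` whose sequence of partial quotients is obtained from that of
`y` by inserting the blocks. -/
noncomputable def insertedPoint (n : ℕ → ℕ) (w : ℕ → List GaussianInt) (y : ℂ) : ℂ :=
  Function.invFunOn digits irrationals (insertBlocks n w (digits y))

/-- The modified seed set `{x(y) : y ∈ S}`. -/
noncomputable def modifiedSeedSet (n : ℕ → ℕ) (w : ℕ → List GaussianInt) : Set ℂ :=
  insertedPoint n w '' seedSet

/-- The inverse `f` of `y ∈ S ↦ x(y)`, which deletes the inserted partial quotients. -/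
noncomputable def deletionMap (n : ℕ → ℕ) (w : ℕ → List GaussianInt) : ℂ → ℂ :=
  Function.invFunOn (insertedPoint n w) seedSet

end Hurwitz

namespace Hurwitz

/-! ### Rounding, norm bounds and distances along Hurwitz orbits -/

open Complex Filter Topology

/-! Once every digit has sup norm at least `3`, no admissibility constraint remains. A tail `t` with
`‖t‖ ≤ 1/2` gives `‖(d + t)⁻¹‖ ≤ 2/5`, so tails stay strictly inside the unit square, the continued
fraction converges geometrically, and rounding recovers each digit. Hence every such sequence
belongs to exactly one irrational point (`digits_value`, `eq_of_digits_eq`), and blocks can be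
inserted freely.

The inserted squares have norms in `[2·3^m, 3^(m+1))`, the gap left between consecutive seed terms,
so all digits stay distinct (`insertBlocks_seq_injective`). Their sides tend to infinity, so they
eventually contain translates of any finite set (`infinite_homothetic_copies`).

Distances are read off from `norm_sub_eq_prod`: over a common prefix, the distance is a product of
orbit norms, each comparable to the reciprocal of a digit. If two seeds first differ at index `N`,
they are at most `3^(-(N² - N))` apart. The inserted points are at least a constant times `3^(-((1 +
4ε)N² + 7N))` apart, because the inserted digits add at most `2εN²` to the exponent of the digit
product, which enters squared. The spare `εN²` in the Hölder exponent `1/(1 + 5ε)` absorbs the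
linear terms (`exists_holder_bound`).

Finally, the seed set has dimension at least `1` (`one_le_dimH_seedSet`). Level `j` offers `9^(j+1)`
choices, so a mixed radix expansion embeds `[0,1)` in the seeds. Agreement to depth `N` means about
`3^(-N²)` on both sides up to linear terms in the exponent, so decoding is `p`-Hölder for every `p <
1`. The deletion map carries the dimension bound over to the modified seeds. -/

theorem round_add_of_mem {t : ℂ} (ht : t ∈ unitSquare) (d : GaussianInt) :
    round ((d : ℂ) + t) = d := by
  obtain ⟨h1, h2, h3, h4⟩ := ht
  have e1 : ((d : ℂ) + t).re = d.re + t.re := by simp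
  have e2 : ((d : ℂ) + t).im = d.im + t.im := by simp
  apply Zsqrtd.ext
  · simp only [round]
    rw [e1, Int.floor_eq_iff]
    constructor <;> linarith
  · simp only [round]
    rw [e2, Int.floor_eq_iff]
    constructor <;> linarith

theorem sub_round_mem (z : ℂ) : z - (round z : ℂ) ∈ unitSquare := by
  have h1 := Int.floor_le (z.re + 1 / 2)
  have h2 := Int.lt_floor_add_one (z.re + 1 / 2)
  have h3 := Int.floor_le (z.im + 1 / 2)
  have h4 := Int.lt_floor_add_one (z.im + 1 / 2)
  have e1 : (z - (round z : ℂ)).re = z.re - ⌊z.re + 1 / 2⌋ := by simp [round]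
  have e2 : (z - (round z : ℂ)).im = z.im - ⌊z.im + 1 / 2⌋ := by simp [round]
  refine ⟨?_, ?_, ?_, ?_⟩ <;> first | rw [e1] | rw [e2]
  all_goals linarith

theorem mem_unitSquare_of_norm_lt {z : ℂ} (h : ‖z‖ < 1 / 2) : z ∈ unitSquare := by
  have h1 := (abs_le.1 ((abs_re_le_norm z).trans h.le))
  have h2 := (abs_le.1 ((abs_im_le_norm z).trans h.le))
  have h3 := lt_of_le_of_lt ((le_abs_self _).trans (abs_re_le_norm z)) h
  have h4 := lt_of_le_of_lt ((le_abs_self _).trans (abs_im_le_norm z)) h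
  exact ⟨by linarith [h1.1], h3, by linarith [h2.1], h4⟩

theorem abs_re_le_of_mem {t : ℂ} (ht : t ∈ unitSquare) : |t.re| ≤ 1 / 2 :=
  abs_le.2 ⟨ht.1, ht.2.1.le⟩

theorem abs_im_le_of_mem {t : ℂ} (ht : t ∈ unitSquare) : |t.im| ≤ 1 / 2 :=
  abs_le.2 ⟨ht.2.2.1, ht.2.2.2.le⟩

theorem supNorm_cast (d : GaussianInt) :
    ((supNorm d : ℤ) : ℝ) = max |(d.re : ℝ)| |(d.im : ℝ)| := by
  simp [supNorm]

theorem supNorm_sub_le_norm_add {t : ℂ} (hr : |t.re| ≤ 1 / 2) (hi : |t.im| ≤ 1 / 2)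
    (d : GaussianInt) : (supNorm d : ℝ) - 1 / 2 ≤ ‖(d : ℂ) + t‖ := by
  have e1 : ((d : ℂ) + t).re = d.re + t.re := by simp
  have e2 : ((d : ℂ) + t).im = d.im + t.im := by simp
  have h1 := abs_re_le_norm ((d : ℂ) + t)
  have h2 := abs_im_le_norm ((d : ℂ) + t)
  rw [e1] at h1
  rw [e2] at h2
  have h3 := abs_sub_abs_le_abs_sub (d.re : ℝ) (-t.re)
  have h4 := abs_sub_abs_le_abs_sub (d.im : ℝ) (-t.im)
  rw [abs_neg, sub_neg_eq_add] at h3 h4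
  rw [supNorm_cast, sub_le_iff_le_add]
  apply max_le <;> linarith

theorem norm_add_le_supNorm {t : ℂ} (hr : |t.re| ≤ 1 / 2) (hi : |t.im| ≤ 1 / 2)
    (d : GaussianInt) : ‖(d : ℂ) + t‖ ≤ 2 * supNorm d + 1 := by
  have e1 : ((d : ℂ) + t).re = d.re + t.re := by simp
  have e2 : ((d : ℂ) + t).im = d.im + t.im := by simp
  have h := norm_le_abs_re_add_abs_im ((d : ℂ) + t)
  rw [e1, e2] at h
  have h3 := abs_add_le (d.re : ℝ) t.re
  have h4 := abs_add_le (d.im : ℝ) t.im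
  rw [supNorm_cast]
  have h5 := le_max_left |(d.re : ℝ)| |(d.im : ℝ)|
  have h6 := le_max_right |(d.re : ℝ)| |(d.im : ℝ)|
  linarith

theorem abs_le_half_of_norm {z : ℂ} (h : ‖z‖ ≤ 1 / 2) : |z.re| ≤ 1 / 2 ∧ |z.im| ≤ 1 / 2 :=
  ⟨(abs_re_le_norm z).trans h, (abs_im_le_norm z).trans h⟩

/-- Both coordinates are rational. -/
def IsRational (z : ℂ) : Prop := (∃ q : ℚ, z.re = q) ∧ ∃ q : ℚ, z.im = q

theorem IsRational.inv {z : ℂ} (h : IsRational z) : IsRational z⁻¹ := by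
  obtain ⟨⟨p, hp⟩, q, hq⟩ := h
  exact ⟨⟨p / (p * p + q * q), by simp [Complex.inv_re, normSq_apply, hp, hq]⟩,
    ⟨-q / (p * p + q * q), by simp [Complex.inv_im, normSq_apply, hp, hq]⟩⟩

theorem IsRational.gaussianInt_add {z : ℂ} (h : IsRational z) (d : GaussianInt) :
    IsRational ((d : ℂ) + z) := by
  obtain ⟨⟨p, hp⟩, q, hq⟩ := h
  exact ⟨⟨d.re + p, by simp [hp]⟩, ⟨d.im + q, by simp [hq]⟩⟩

theorem hurwitzMap_mem_unitSquare (x : ℂ) : hurwitzMap x ∈ unitSquare := sub_round_mem _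

theorem hurwitzMap_mem {x : ℂ} (hx : x ∈ irrationals) : hurwitzMap x ∈ irrationals := by
  refine ⟨hurwitzMap_mem_unitSquare x, fun h => hx.2 ?_⟩
  have h2 := (IsRational.gaussianInt_add h (round x⁻¹)).inv
  have h3 : ((round x⁻¹ : ℂ) + hurwitzMap x)⁻¹ = x := by simp [hurwitzMap]
  rwa [h3] at h2

theorem iterate_mem {x : ℂ} (hx : x ∈ irrationals) (n : ℕ) : hurwitzMap^[n] x ∈ irrationals := by
  induction n with
  | zero => exact hx
  | succ n ih => rw [Function.iterate_succ_apply']; exact hurwitzMap_mem ih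

theorem ne_zero_of_mem {x : ℂ} (hx : x ∈ irrationals) : x ≠ 0 := by
  rintro rfl
  exact hx.2 ⟨⟨0, by simp⟩, ⟨0, by simp⟩⟩

theorem iterate_inv (x : ℂ) (n : ℕ) :
    (hurwitzMap^[n] x)⁻¹ = (digits x n : ℂ) + hurwitzMap^[n + 1] x := by
  rw [Function.iterate_succ_apply', hurwitzMap, digits]
  ring

theorem norm_iterate_le {x : ℂ} (hx : x ∈ irrationals) (n : ℕ) {B : ℝ} (hB : 0 < B)
    (h : B + 1 / 2 ≤ supNorm (digits x n)) : ‖hurwitzMap^[n] x‖ ≤ B⁻¹ := by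
  have h1 := (iterate_mem hx (n + 1)).1
  have h2 := supNorm_sub_le_norm_add (abs_re_le_of_mem h1) (abs_im_le_of_mem h1) (digits x n)
  rw [← iterate_inv, norm_inv] at h2
  have h3 : B ≤ ‖hurwitzMap^[n] x‖⁻¹ := by linarith
  have := inv_anti₀ hB h3
  rwa [inv_inv] at this

theorem le_norm_iterate {x : ℂ} (hx : x ∈ irrationals) (n : ℕ) :
    (2 * (supNorm (digits x n) : ℝ) + 1)⁻¹ ≤ ‖hurwitzMap^[n] x‖ := by
  have h1 := (iterate_mem hx (n + 1)).1
  have h2 := norm_add_le_supNorm (abs_re_le_of_mem h1) (abs_im_le_of_mem h1) (digits x n)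
  rw [← iterate_inv, norm_inv] at h2
  have h0 : 0 < ‖hurwitzMap^[n] x‖ := norm_pos_iff.2 (ne_zero_of_mem (iterate_mem hx n))
  have := inv_anti₀ (inv_pos.2 h0) h2
  rwa [inv_inv] at this

theorem norm_iterate_sub {x y : ℂ} (hx : x ∈ irrationals) (hy : y ∈ irrationals) (n : ℕ) :
    ‖hurwitzMap^[n] x - hurwitzMap^[n] y‖ = ‖hurwitzMap^[n] x‖ * ‖hurwitzMap^[n] y‖ *
      ‖((digits x n : ℂ) + hurwitzMap^[n + 1] x) - ((digits y n : ℂ) + hurwitzMap^[n + 1] y)‖ := by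
  rw [← iterate_inv, ← iterate_inv]
  have h1 := ne_zero_of_mem (iterate_mem hx n)
  have h2 := ne_zero_of_mem (iterate_mem hy n)
  rw [← norm_mul, ← norm_mul, ← norm_neg]
  congr 1
  field_simp
  ring

/-- Iterates `u⁻¹ - v⁻¹ = (v - u) / (u v)`: equal digits cancel in `v - u` and leave the difference
of the next iterates. -/
theorem norm_sub_eq_prod {x y : ℂ} (hx : x ∈ irrationals) (hy : y ∈ irrationals) (M : ℕ)
    (h : ∀ i < M, digits x i = digits y i) :
    ‖x - y‖ = (∏ i ∈ Finset.range M, ‖hurwitzMap^[i] x‖ * ‖hurwitzMap^[i] y‖) *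
      ‖hurwitzMap^[M] x - hurwitzMap^[M] y‖ := by
  induction M with
  | zero => simp
  | succ M ih =>
    rw [ih fun i hi => h i (by omega), norm_iterate_sub hx hy M, h M (by omega),
      Finset.prod_range_succ, add_sub_add_left_eq_sub]
    ring

theorem norm_iterate_le_two_fifths {x : ℂ} (hx : x ∈ irrationals) (n : ℕ)
    (h : 3 ≤ supNorm (digits x n)) : ‖hurwitzMap^[n] x‖ ≤ 2 / 5 := by
  have h' : (3 : ℝ) ≤ supNorm (digits x n) := by exact_mod_cast h
  have := norm_iterate_le hx n (B := 5 / 2) (by norm_num) (by linarith)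
  norm_num at this ⊢
  exact this

/-- Each common digit contributes a factor at most `(2/5)² < 1/2` to the distance. -/
theorem eq_of_digits_eq {x y : ℂ} (hx : x ∈ irrationals) (hy : y ∈ irrationals)
    (h : digits x = digits y) (h3 : ∀ n, 3 ≤ supNorm (digits x n)) : x = y := by
  have key : ∀ M : ℕ, ‖x - y‖ ≤ (1 / 2) ^ M := by
    intro M
    rw [norm_sub_eq_prod hx hy M fun i _ => congrFun h i]
    have hb : ∀ i, ‖hurwitzMap^[i] x‖ ≤ 2 / 5 ∧ ‖hurwitzMap^[i] y‖ ≤ 2 / 5 := fun i =>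
      ⟨norm_iterate_le_two_fifths hx i (h3 i), norm_iterate_le_two_fifths hy i (h ▸ h3 i)⟩
    have h1 : (∏ i ∈ Finset.range M, ‖hurwitzMap^[i] x‖ * ‖hurwitzMap^[i] y‖) ≤ (1 / 2) ^ M := by
      refine (Finset.prod_le_prod (g := fun _ => (1 / 2 : ℝ)) (fun i _ => by positivity)
        fun i _ => ?_).trans_eq (by simp)
      have := hb i
      nlinarith [norm_nonneg (hurwitzMap^[i] x), norm_nonneg (hurwitzMap^[i] y)]
    have h2 : ‖hurwitzMap^[M] x - hurwitzMap^[M] y‖ ≤ 1 := by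
      have := norm_sub_le (hurwitzMap^[M] x) (hurwitzMap^[M] y)
      linarith [(hb M).1, (hb M).2]
    calc _ ≤ (1 / 2 : ℝ) ^ M * 1 := mul_le_mul h1 h2 (norm_nonneg _) (by positivity)
      _ = _ := mul_one _
  have h0 : ‖x - y‖ ≤ 0 :=
    ge_of_tendsto' (tendsto_pow_atTop_nhds_zero_of_lt_one (by norm_num) (by norm_num)) key
  exact sub_eq_zero.1 (norm_le_zero_iff.1 h0)

/-- Distinct Gaussian integers are at least `1` apart, and the tails behind them have norm at most
`2/5` each, which leaves `1 - 4/5 = 1/5`. This is why the digits at `M + 1` must be large. -/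
theorem le_norm_sub {x y : ℂ} (hx : x ∈ irrationals) (hy : y ∈ irrationals) (M : ℕ)
    (h : ∀ i < M, digits x i = digits y i) (hM : digits x M ≠ digits y M)
    (hx3 : 3 ≤ supNorm (digits x (M + 1))) (hy3 : 3 ≤ supNorm (digits y (M + 1))) :
    (1 / 5 : ℝ) * ((∏ i ∈ Finset.range M, (2 * (supNorm (digits x i) : ℝ) + 1)⁻¹) ^ 2 *
      ((2 * (supNorm (digits x M) : ℝ) + 1)⁻¹ * (2 * (supNorm (digits y M) : ℝ) + 1)⁻¹))
      ≤ ‖x - y‖ := by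
  have hpos : ∀ d : GaussianInt, (0 : ℝ) ≤ (2 * (supNorm d : ℝ) + 1)⁻¹ := fun d => by
    rw [supNorm_cast]; positivity
  have hd : (1 / 5 : ℝ) ≤ ‖((digits x M : ℂ) + hurwitzMap^[M + 1] x) -
      ((digits y M : ℂ) + hurwitzMap^[M + 1] y)‖ := by
    have h1 := norm_iterate_le_two_fifths hx _ hx3
    have h2 := norm_iterate_le_two_fifths hy _ hy3
    have h3 : 1 ≤ ‖(digits x M : ℂ) - digits y M‖ := by
      have hne : digits x M - digits y M ≠ 0 := sub_ne_zero.2 hM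
      have := GaussianInt.norm_pos.2 hne
      have h4 : (1 : ℝ) ≤ ((digits x M - digits y M).norm : ℝ) := by exact_mod_cast this
      rw [GaussianInt.intCast_real_norm, GaussianInt.toComplex_sub, Complex.normSq_eq_norm_sq] at h4
      nlinarith [norm_nonneg ((digits x M : ℂ) - digits y M)]
    have h5 : ((digits x M : ℂ) - digits y M) = (((digits x M : ℂ) + hurwitzMap^[M + 1] x) -
      ((digits y M : ℂ) + hurwitzMap^[M + 1] y)) - (hurwitzMap^[M + 1] x - hurwitzMap^[M + 1] y) := by
      ring
    rw [h5] at h3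
    have h6 := norm_sub_le (((digits x M : ℂ) + hurwitzMap^[M + 1] x) -
      ((digits y M : ℂ) + hurwitzMap^[M + 1] y)) (hurwitzMap^[M + 1] x - hurwitzMap^[M + 1] y)
    have h7 := norm_sub_le (hurwitzMap^[M + 1] x) (hurwitzMap^[M + 1] y)
    linarith
  rw [norm_sub_eq_prod hx hy M h, norm_iterate_sub hx hy M, mul_comm (1 / 5 : ℝ), mul_assoc]
  have hprod : (∏ i ∈ Finset.range M, (2 * (supNorm (digits x i) : ℝ) + 1)⁻¹) ^ 2 ≤
      ∏ i ∈ Finset.range M, ‖hurwitzMap^[i] x‖ * ‖hurwitzMap^[i] y‖ := by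
    rw [← Finset.prod_pow]
    refine Finset.prod_le_prod (fun i _ => sq_nonneg _) fun i hi => ?_
    have h2 := le_norm_iterate hy i
    rw [← h i (Finset.mem_range.1 hi)] at h2
    rw [sq]
    exact mul_le_mul (le_norm_iterate hx i) h2 (hpos _) (norm_nonneg _)
  have hM' := mul_le_mul (le_norm_iterate hx M) (le_norm_iterate hy M) (hpos _) (norm_nonneg _)
  gcongr
  exact mul_nonneg (mul_nonneg (hpos _) (hpos _)) (by norm_num)

/-! ### Rational points have orbits that reach zero -/

/-- Euclid's algorithm in the Gaussian integers: points of the square have modulus below `1`, so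
passing from `p / q` to `(q - round x⁻¹ * p) / p` lowers the norm of the denominator. -/
theorem exists_iterate_eq_zero (m : ℕ) : ∀ (x : ℂ) (p q : GaussianInt), q.norm.natAbs ≤ m → q ≠ 0 →
    x ∈ unitSquare → x = p / q → ∃ n, hurwitzMap^[n] x = 0 := by
  induction m with
  | zero =>
    intro x p q hq hq0
    have := GaussianInt.norm_pos.2 hq0
    omega
  | succ m ih =>
    intro x p q hq hq0 hxU hx
    by_cases hp : p = 0
    · exact ⟨0, by simp [hx, hp]⟩
    have hqC : (q : ℂ) ≠ 0 := fun h => hq0 (GaussianInt.toComplex_eq_zero.1 h)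
    have hpC : (p : ℂ) ≠ 0 := fun h => hp (GaussianInt.toComplex_eq_zero.1 h)
    have hlt : p.norm < q.norm := by
      have h1 := abs_re_le_of_mem hxU
      have h2 := abs_im_le_of_mem hxU
      have h3 : normSq x < 1 := by
        rw [normSq_apply]
        nlinarith [abs_le.1 h1, abs_le.1 h2]
      rw [hx, normSq_div, div_lt_one (normSq_pos.2 hqC), ← GaussianInt.intCast_real_norm,
        ← GaussianInt.intCast_real_norm] at h3
      exact_mod_cast h3
    obtain ⟨n, hn⟩ := ih (hurwitzMap x) (q - round x⁻¹ * p) p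
      (by have := GaussianInt.norm_nonneg p; omega) hp (hurwitzMap_mem_unitSquare x)
      (by
        rw [hurwitzMap, GaussianInt.toComplex_sub, GaussianInt.toComplex_mul, sub_div,
          mul_div_cancel_right₀ _ hpC]
        congr 1
        rw [hx, inv_div])
    exact ⟨n + 1, hn⟩

theorem IsRational.exists_iterate_eq_zero {x : ℂ} (hU : x ∈ unitSquare) (h : IsRational x) :
    ∃ n, hurwitzMap^[n] x = 0 := by
  obtain ⟨⟨p, hp⟩, q, hq⟩ := h
  refine Hurwitz.exists_iterate_eq_zero _ x ⟨p.num * q.den, q.num * p.den⟩ ⟨p.den * q.den, 0⟩ le_rfl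
    (fun h0 => ?_) hU ?_
  · have := congrArg Zsqrtd.re h0
    simp at this
  · have h1 : (p.den : ℂ) ≠ 0 := by simp
    have h2 : (q.den : ℂ) ≠ 0 := by simp
    have hx : x = (p : ℂ) + (q : ℂ) * I := by
      apply Complex.ext <;> simp [hp, hq]
    rw [hx, GaussianInt.toComplex_def, GaussianInt.toComplex_def]
    have e1 : (p : ℂ) = p.num / p.den := by exact_mod_cast (Rat.num_div_den p).symm
    have e2 : (q : ℂ) = q.num / q.den := by exact_mod_cast (Rat.num_div_den q).symm
    rw [e1, e2]
    push_cast
    field_simp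
    ring

/-! ### Existence of a point with prescribed large digits -/

/-- The finite continued fraction with partial quotients `d 0, …, d (m - 1)`. -/
noncomputable def convergent : ℕ → (ℕ → GaussianInt) → ℂ
  | 0, _ => 0
  | m + 1, d => ((d 0 : ℂ) + convergent m fun n => d (n + 1))⁻¹

theorem norm_inv_add_le {d : GaussianInt} (hd : 3 ≤ supNorm d) {t : ℂ} (ht : ‖t‖ ≤ 1 / 2) :
    ‖((d : ℂ) + t)⁻¹‖ ≤ 2 / 5 := by
  obtain ⟨h1, h2⟩ := abs_le_half_of_norm ht
  have h3 := supNorm_sub_le_norm_add h1 h2 d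
  have h4 : (3 : ℝ) ≤ supNorm d := by exact_mod_cast hd
  have h5 : (5 / 2 : ℝ) ≤ ‖(d : ℂ) + t‖ := by linarith
  have := inv_anti₀ (by norm_num) h5
  rw [norm_inv]
  norm_num at this ⊢
  exact this

theorem norm_convergent_le (m : ℕ) : ∀ d : ℕ → GaussianInt, (∀ n, 3 ≤ supNorm (d n)) →
    ‖convergent m d‖ ≤ 2 / 5 := by
  induction m with
  | zero => intro d _; simp [convergent]; norm_num
  | succ m ih =>
    intro d hd
    exact norm_inv_add_le (hd 0) ((ih _ fun n => hd (n + 1)).trans (by norm_num))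

theorem add_ne_zero_of_norm_le {d : GaussianInt} (hd : 3 ≤ supNorm d) {t : ℂ} (ht : ‖t‖ ≤ 1 / 2) :
    (d : ℂ) + t ≠ 0 := by
  obtain ⟨h1, h2⟩ := abs_le_half_of_norm ht
  have h3 := supNorm_sub_le_norm_add h1 h2 d
  have h4 : (3 : ℝ) ≤ supNorm d := by exact_mod_cast hd
  exact norm_pos_iff.1 (by linarith)

/-- Prepending a digit contracts distances by `(2/5)² ≤ 1/2`. The factor `1 *` matches
`cauchySeq_of_le_geometric`. -/
theorem dist_convergent_le (m : ℕ) : ∀ d : ℕ → GaussianInt, (∀ n, 3 ≤ supNorm (d n)) →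
    dist (convergent m d) (convergent (m + 1) d) ≤ 1 * (1 / 2) ^ m := by
  induction m with
  | zero =>
    intro d hd
    have := norm_convergent_le 1 d hd
    rw [dist_eq_norm, convergent, zero_sub, norm_neg]
    linarith
  | succ m ih =>
    intro d hd
    have hd' : ∀ n, 3 ≤ supNorm (d (n + 1)) := fun n => hd (n + 1)
    have h := ih _ hd'
    have h1 := (norm_convergent_le m _ hd').trans (by norm_num : (2 / 5 : ℝ) ≤ 1 / 2)
    have h2 := (norm_convergent_le (m + 1) _ hd').trans (by norm_num : (2 / 5 : ℝ) ≤ 1 / 2)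
    have e : ∀ k, convergent (k + 1) d = ((d 0 : ℂ) + convergent k fun n => d (n + 1))⁻¹ :=
      fun k => rfl
    rw [e m, e (m + 1)]
    rw [dist_inv_inv₀ (add_ne_zero_of_norm_le (hd 0) h1) (add_ne_zero_of_norm_le (hd 0) h2),
      dist_add_left, div_eq_mul_inv, mul_inv, ← norm_inv, ← norm_inv, pow_succ]
    have h3 := norm_inv_add_le (hd 0) h1
    have h4 := norm_inv_add_le (hd 0) h2
    rw [← mul_assoc (1 : ℝ)]
    refine mul_le_mul h ?_ (by positivity) (by positivity)
    calc _ ≤ (2 / 5 : ℝ) * (2 / 5) := mul_le_mul h3 h4 (norm_nonneg _) (by norm_num)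
      _ ≤ _ := by norm_num

/-- The infinite continued fraction with partial quotients `d`. -/
noncomputable def value (d : ℕ → GaussianInt) : ℂ := limUnder atTop fun m => convergent m d

theorem tendsto_convergent {d : ℕ → GaussianInt} (hd : ∀ n, 3 ≤ supNorm (d n)) :
    Tendsto (fun m => convergent m d) atTop (𝓝 (value d)) :=
  (cauchySeq_of_le_geometric (1 / 2) 1 (by norm_num)
    fun m => dist_convergent_le m d hd).tendsto_limUnder

theorem norm_value_le {d : ℕ → GaussianInt} (hd : ∀ n, 3 ≤ supNorm (d n)) :
    ‖value d‖ ≤ 2 / 5 :=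
  le_of_tendsto' (tendsto_convergent hd).norm fun m => norm_convergent_le m d hd

theorem value_eq {d : ℕ → GaussianInt} (hd : ∀ n, 3 ≤ supNorm (d n)) :
    value d = ((d 0 : ℂ) + value fun n => d (n + 1))⁻¹ := by
  have hd' : ∀ n, 3 ≤ supNorm (d (n + 1)) := fun n => hd (n + 1)
  refine tendsto_nhds_unique ((tendsto_add_atTop_iff_nat 1).2 (tendsto_convergent hd)) ?_
  exact ((tendsto_convergent hd').const_add _).inv₀
    (add_ne_zero_of_norm_le (hd 0) ((norm_value_le hd').trans (by norm_num)))

theorem value_mem_unitSquare {d : ℕ → GaussianInt} (hd : ∀ n, 3 ≤ supNorm (d n)) :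
    value d ∈ unitSquare :=
  mem_unitSquare_of_norm_lt ((norm_value_le hd).trans_lt (by norm_num))

theorem hurwitzMap_iterate_value (n : ℕ) : ∀ d : ℕ → GaussianInt, (∀ n, 3 ≤ supNorm (d n)) →
    hurwitzMap^[n] (value d) = value fun i => d (i + n) := by
  induction n with
  | zero => intro d _; rfl
  | succ n ih =>
    intro d hd
    have hd' : ∀ n, 3 ≤ supNorm (d (n + 1)) := fun n => hd (n + 1)
    have h : hurwitzMap (value d) = value fun n => d (n + 1) := by
      rw [value_eq hd, hurwitzMap, inv_inv, round_add_of_mem (value_mem_unitSquare hd')]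
      ring
    rw [Function.iterate_succ_apply, h, ih _ hd']
    congr 1

theorem value_ne_zero {d : ℕ → GaussianInt} (hd : ∀ n, 3 ≤ supNorm (d n)) : value d ≠ 0 := by
  rw [value_eq hd]
  exact inv_ne_zero (add_ne_zero_of_norm_le (hd 0)
    ((norm_value_le fun n => hd (n + 1)).trans (by norm_num)))

/-- A rational value would have an iterate equal to zero, but the iterates are values of shifted
sequences, hence inverses of nonzero numbers. -/
theorem value_mem_irrationals {d : ℕ → GaussianInt} (hd : ∀ n, 3 ≤ supNorm (d n)) :
    value d ∈ irrationals := by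
  refine ⟨value_mem_unitSquare hd, fun h => ?_⟩
  obtain ⟨n, hn⟩ := IsRational.exists_iterate_eq_zero (value_mem_unitSquare hd) h
  rw [hurwitzMap_iterate_value n d hd] at hn
  exact value_ne_zero (fun i => hd (i + n)) hn

theorem digits_value {d : ℕ → GaussianInt} (hd : ∀ n, 3 ≤ supNorm (d n)) :
    digits (value d) = d := by
  funext n
  rw [digits, hurwitzMap_iterate_value n d hd, value_eq fun i => hd (i + n), inv_inv,
    round_add_of_mem (value_mem_unitSquare fun i => hd (i + 1 + n))]
  simp

end Hurwitz

namespace Hurwitz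

/-! ### Insertion of blocks into a sequence -/

section Insertion

variable {n : ℕ → ℕ} {w : ℕ → List GaussianInt}

theorem insertPrefix_succ (a : ℕ → GaussianInt) (M : ℕ) :
    insertPrefix n w a (M + 1) = insertPrefix n w a M ++ (a M :: block n w (M + 1)) := by
  simp [insertPrefix, List.range_succ]

theorem insertPrefix_prefix (a : ℕ → GaussianInt) {M N : ℕ} (h : M ≤ N) :
    insertPrefix n w a M <+: insertPrefix n w a N := by
  induction N, h using Nat.le_induction with
  | base => exact List.prefix_refl _
  | succ N _ ih => exact ih.trans ⟨_, (insertPrefix_succ a N).symm⟩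

theorem getElem_insertPrefix (a : ℕ → GaussianInt) {M i : ℕ}
    (h : i < (insertPrefix n w a M).length) :
    (insertPrefix n w a M)[i] = insertBlocks n w a i := by
  rw [insertBlocks]
  rcases le_total M (i + 1) with h1 | h1
  · exact (insertPrefix_prefix a h1).getElem h
  · exact ((insertPrefix_prefix a h1).getElem (le_length_insertPrefix n w a (i + 1))).symm

theorem insertPrefix_eq_map (a : ℕ → GaussianInt) (M : ℕ) :
    insertPrefix n w a M =
      (List.range (insertPrefix n w a M).length).map (insertBlocks n w a) := by
  apply List.ext_getElem
  · simp
  · intro i h1 h2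
    simp [getElem_insertPrefix]

theorem prod_insertBlocks (a : ℕ → GaussianInt) (M : ℕ) (f : GaussianInt → ℝ) :
    ∏ i ∈ Finset.range (insertPrefix n w a M).length, f (insertBlocks n w a i) =
      ((insertPrefix n w a M).map f).prod := by
  conv_rhs => rw [insertPrefix_eq_map, List.map_map]
  rfl

theorem length_insertPrefix (a b : ℕ → GaussianInt) (M : ℕ) :
    (insertPrefix n w a M).length = (insertPrefix n w b M).length := by
  induction M with
  | zero => rfl
  | succ M ih => simp [insertPrefix_succ, ih]

/-- Prefix lengths do not depend on the seed, so a first disagreement of two seeds at `M` reappears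
at this same index in both modified sequences. -/
theorem insertBlocks_length (a : ℕ → GaussianInt) (M : ℕ) :
    insertBlocks n w a (insertPrefix n w a M).length = a M := by
  have h : (insertPrefix n w a M).length < (insertPrefix n w a (M + 1)).length := by
    simp [insertPrefix_succ]
  rw [← getElem_insertPrefix a h]
  simp [insertPrefix_succ]

theorem insertBlocks_injective : Function.Injective (insertBlocks n w) := by
  intro a b h
  funext M
  rw [← insertBlocks_length (n := n) (w := w) a M, length_insertPrefix a b M, h, insertBlocks_length]

theorem insertPrefix_congr {a b : ℕ → GaussianInt} {M : ℕ} (h : ∀ i < M, a i = b i) :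
    insertPrefix n w a M = insertPrefix n w b M := by
  induction M with
  | zero => rfl
  | succ M ih =>
    rw [insertPrefix_succ, insertPrefix_succ, ih fun i hi => h i (by omega), h M (by omega)]

theorem insertBlocks_congr {a b : ℕ → GaussianInt} {M : ℕ} (h : ∀ i < M, a i = b i) {i : ℕ}
    (hi : i < (insertPrefix n w a M).length) : insertBlocks n w a i = insertBlocks n w b i := by
  have hi' := hi
  rw [length_insertPrefix a b] at hi'
  rw [← getElem_insertPrefix a hi, ← getElem_insertPrefix b hi']
  congr 1
  exact insertPrefix_congr h

theorem insertBlocks_mem (a : ℕ → GaussianInt) (i : ℕ) :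
    insertBlocks n w a i ∈ insertPrefix n w a (i + 1) := List.getElem_mem _

theorem mem_insertPrefix {a : ℕ → GaussianInt} {M : ℕ} {u : GaussianInt} :
    u ∈ insertPrefix n w a M ↔ ∃ j < M, u ∈ a j :: block n w (j + 1) := by
  simp only [insertPrefix, List.mem_flatMap, List.mem_range]

theorem mem_block {j : ℕ} {u : GaussianInt} (h : u ∈ block n w j) : ∃ k, n k = j ∧ u ∈ w k := by
  simp only [block, List.mem_flatMap] at h
  obtain ⟨k, -, hk⟩ := h
  by_cases hj : n k = j
  · exact ⟨k, hj, by simpa [hj] using hk⟩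
  · simp [hj] at hk

theorem block_eq_nil {j : ℕ} (h : ∀ k, n k ≠ j) : block n w j = [] :=
  List.eq_nil_iff_forall_not_mem.2 fun u hu => by
    obtain ⟨k, hk, -⟩ := mem_block hu
    exact h k hk

theorem lt_apply_of_strictMono (hn : StrictMono n) (hpos : ∀ k, 0 < n k) (k : ℕ) : k < n k := by
  induction k with
  | zero => exact hpos 0
  | succ k ih => exact lt_of_le_of_lt ih (hn (Nat.lt_succ_self k))

theorem block_apply (hn : StrictMono n) (hpos : ∀ k, 0 < n k) (k : ℕ) :
    block n w (n k) = w k := by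
  have key : ∀ j, ((List.range j).flatMap fun i => if n i = n k then w i else []) =
      if k < j then w k else [] := by
    intro j
    induction j with
    | zero => simp
    | succ j ih =>
      rw [List.range_succ, List.flatMap_append, ih]
      rcases lt_trichotomy k j with h | h | h
      · have : n j ≠ n k := fun e => h.ne' (hn.injective e)
        simp [h, this, h.trans (Nat.lt_succ_self j)]
      · subst h; simp
      · have h' : ¬ k < j + 1 := by omega
        have : n j ≠ n k := fun e => h.ne (hn.injective e)
        simp [h', h.not_gt, this]
  rw [block, key, if_pos (lt_apply_of_strictMono hn hpos k)]

end Insertion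

/-! ### The squares and the digits of the inserted points -/

theorem square_bounds {ε : ℝ} (hε : 0 ≤ ε) {m : ℕ}
    (hgap : (3 : ℝ) ^ (m + 1) > 2 * 3 ^ m + √(2 * ε * m)) {u : GaussianInt} (hu : u ∈ square ε m) :
    2 * 3 ^ m ≤ supNorm u ∧ supNorm u < 3 ^ (m + 1) := by
  obtain ⟨z, h1, h2, h3, rfl⟩ := hu
  have hs : √(ε * m) ≤ √(2 * ε * m) := Real.sqrt_le_sqrt (by
    have : 0 ≤ ε * m := by positivity
    linarith)
  have h4 : ((supNorm z : ℤ) : ℝ) + 2 * 3 ^ m < 3 ^ (m + 1) := by linarith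
  have h5 : supNorm z + 2 * 3 ^ m < 3 ^ (m + 1) := by exact_mod_cast h4
  have e1 : ((⟨2 * 3 ^ m, 2 * 3 ^ m⟩ : GaussianInt) + z).re = 2 * 3 ^ m + z.re := rfl
  have e2 : ((⟨2 * 3 ^ m, 2 * 3 ^ m⟩ : GaussianInt) + z).im = 2 * 3 ^ m + z.im := rfl
  have hp : (0 : ℤ) < 3 ^ m := by positivity
  simp only [supNorm] at h5 ⊢
  rw [abs_of_nonneg h1, abs_of_nonneg h2] at h5
  rw [e1, e2, abs_of_nonneg (by omega), abs_of_nonneg (by omega)]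
  omega

/-- The `- 1` in the side condition leaves at most `⌊√(ε m)⌋` values per coordinate, whence at most
`ε m` points. -/
theorem square_subset_image (ε : ℝ) (m : ℕ) :
    square ε m ⊆ ((Finset.range ⌊√(ε * m)⌋₊ ×ˢ Finset.range ⌊√(ε * m)⌋₊).image
      fun p : ℕ × ℕ => (⟨2 * 3 ^ m, 2 * 3 ^ m⟩ + ⟨p.1, p.2⟩ : GaussianInt) : Finset GaussianInt) := by
  rintro _ ⟨⟨p, q⟩, h1, h2, h3, rfl⟩
  rw [supNorm_cast] at h3
  lift p to ℕ using h1
  lift q to ℕ using h2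
  have hp := (le_max_left _ _).trans h3
  have hq := (le_max_right _ _).trans h3
  have key : ∀ r : ℕ, |((r : ℤ) : ℝ)| ≤ √(ε * m) - 1 → r < ⌊√(ε * m)⌋₊ := fun r hr => by
    rw [Int.cast_natCast, Nat.abs_cast] at hr
    apply Nat.le_floor
    push_cast
    linarith
  simp only [Finset.coe_image, Set.mem_image, Finset.mem_coe, Finset.mem_product, Finset.mem_range]
  exact ⟨(p, q), ⟨key p hp, key q hq⟩, rfl⟩

theorem square_finite (ε : ℝ) (m : ℕ) : (square ε m).Finite :=
  (Finset.finite_toSet _).subset (square_subset_image ε m)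

theorem length_le_of_enumeration {ε : ℝ} (hε : 0 ≤ ε) {m : ℕ} {l : List GaussianInt}
    (hl : l.Nodup) (h : ∀ u, u ∈ l ↔ u ∈ square ε m) : (l.length : ℝ) ≤ ε * m := by
  have h1 : l.toFinset ⊆ (Finset.range ⌊√(ε * m)⌋₊ ×ˢ Finset.range ⌊√(ε * m)⌋₊).image
      fun p : ℕ × ℕ => (⟨2 * 3 ^ m, 2 * 3 ^ m⟩ + ⟨p.1, p.2⟩ : GaussianInt) := fun u hu =>
    square_subset_image ε m ((h u).1 (List.mem_toFinset.1 hu))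
  have h2 := (Finset.card_le_card h1).trans Finset.card_image_le
  rw [List.toFinset_card_of_nodup hl, Finset.card_product, Finset.card_range] at h2
  have h3 : ((⌊√(ε * m)⌋₊ : ℕ) : ℝ) ≤ √(ε * m) := Nat.floor_le (Real.sqrt_nonneg _)
  have h4 : (l.length : ℝ) ≤ (⌊√(ε * m)⌋₊ : ℝ) * ⌊√(ε * m)⌋₊ := by exact_mod_cast h2
  calc (l.length : ℝ) ≤ √(ε * m) * √(ε * m) :=
        h4.trans (mul_le_mul h3 h3 (by positivity) (by positivity))
    _ = ε * m := Real.mul_self_sqrt (by positivity)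

/-- `3ʲ⁺¹ ≤ ‖aⱼ‖∞ < 2 · 3ʲ⁺¹` for all `j`. -/
def IsSeed (a : ℕ → GaussianInt) : Prop :=
  ∀ j, 3 ^ (j + 1) ≤ supNorm (a j) ∧ supNorm (a j) < 2 * 3 ^ (j + 1)

section Admissible

variable {ε : ℝ} {n : ℕ → ℕ} {w : ℕ → List GaussianInt} {a : ℕ → GaussianInt}

theorem block_bounds (hε : 0 ≤ ε) (hn : IsAdmissible ε n) (hw : IsEnumeration ε n w) {j : ℕ}
    {u : GaussianInt} (hu : u ∈ block n w j) : 2 * 3 ^ j ≤ supNorm u ∧ supNorm u < 3 ^ (j + 1) := by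
  obtain ⟨k, rfl, hk⟩ := mem_block hu
  exact square_bounds hε (hn.gap k) (((hw k).2 u).1 hk)

theorem group_bounds (hε : 0 ≤ ε) (hn : IsAdmissible ε n) (hw : IsEnumeration ε n w)
    (ha : IsSeed a) {j : ℕ} {u : GaussianInt} (hu : u ∈ a j :: block n w (j + 1)) :
    3 ^ (j + 1) ≤ supNorm u ∧ supNorm u < 3 ^ (j + 2) := by
  have hp : (0 : ℤ) < 3 ^ (j + 1) := by positivity
  have h3 : (3 : ℤ) ^ (j + 2) = 3 * 3 ^ (j + 1) := by ring
  rcases List.mem_cons.1 hu with rfl | hu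
  · have := ha j
    omega
  · have := block_bounds hε hn hw hu
    rw [show j + 1 + 1 = j + 2 from rfl] at this
    omega

theorem three_le_supNorm_insertBlocks (hε : 0 ≤ ε) (hn : IsAdmissible ε n)
    (hw : IsEnumeration ε n w) (ha : IsSeed a) (i : ℕ) : 3 ≤ supNorm (insertBlocks n w a i) := by
  obtain ⟨j, -, hj⟩ := mem_insertPrefix.1 (insertBlocks_mem (n := n) (w := w) a i)
  refine le_trans ?_ (group_bounds hε hn hw ha hj).1
  exact le_self_pow₀ (by norm_num) (by omega)

theorem nodup_block (hn : IsAdmissible ε n) (hw : IsEnumeration ε n w) (j : ℕ) :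
    (block n w j).Nodup := by
  by_cases h : ∃ k, n k = j
  · obtain ⟨k, rfl⟩ := h
    rw [block_apply hn.strictMono hn.pos]
    exact (hw k).1
  · push Not at h
    rw [block_eq_nil h]
    exact List.nodup_nil

/-- The `j`-th seed term and the block behind it have norms in `[3^(j+1), 3^(j+2))`, and these
shells are disjoint. Inside a shell, `2·3^(j+1)` separates the seed term from the block. -/
theorem nodup_insertPrefix (hε : 0 ≤ ε) (hn : IsAdmissible ε n) (hw : IsEnumeration ε n w)
    (ha : IsSeed a) (M : ℕ) : (insertPrefix n w a M).Nodup := by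
  induction M with
  | zero => exact List.nodup_nil
  | succ M ih =>
    rw [insertPrefix_succ]
    refine ih.append (List.nodup_cons.2 ⟨fun h => ?_, nodup_block hn hw _⟩) ?_
    · have h1 := block_bounds hε hn hw h
      have h2 := ha M
      omega
    · intro u hu hu'
      obtain ⟨j, hj, hj'⟩ := mem_insertPrefix.1 hu
      have h1 := (group_bounds hε hn hw ha hj').2
      have h2 := (group_bounds hε hn hw ha hu').1
      have h3 : (3 : ℤ) ^ (j + 2) ≤ 3 ^ (M + 1) := pow_le_pow_right₀ (by norm_num) (by omega)
      omega

theorem insertBlocks_seq_injective (hε : 0 ≤ ε) (hn : IsAdmissible ε n)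
    (hw : IsEnumeration ε n w) (ha : IsSeed a) : Function.Injective (insertBlocks n w a) := by
  intro i j hij
  have hi : i < (insertPrefix n w a (max i j + 1)).length :=
    lt_of_lt_of_le (by omega) (le_length_insertPrefix n w a _)
  have hj : j < (insertPrefix n w a (max i j + 1)).length :=
    lt_of_lt_of_le (by omega) (le_length_insertPrefix n w a _)
  rw [← getElem_insertPrefix a hi, ← getElem_insertPrefix a hj] at hij
  exact (nodup_insertPrefix hε hn hw ha _).getElem_inj_iff.1 hij

theorem square_subset_range (hn : IsAdmissible ε n) (hw : IsEnumeration ε n w) (k : ℕ) :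
    square ε (n k) ⊆ Set.range (insertBlocks n w a) := by
  intro u hu
  -- Seed terms are indexed from `0`, so the block for `n k` follows the term of index `n k - 1`.
  obtain ⟨m, hm⟩ := Nat.exists_eq_add_of_lt (hn.pos k)
  have h : u ∈ insertPrefix n w a (n k) := by
    refine mem_insertPrefix.2 ⟨m, by omega, List.mem_cons_of_mem _ ?_⟩
    rw [show m + 1 = n k by omega, block_apply hn.strictMono hn.pos]
    exact ((hw k).2 u).2 hu
  obtain ⟨i, hi, rfl⟩ := List.getElem_of_mem h
  exact ⟨i, (getElem_insertPrefix a hi).symm⟩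

theorem infinite_homothetic_copies (hε : 0 < ε) (hn : IsAdmissible ε n)
    (hw : IsEnumeration ε n w) {A : Set GaussianInt} (hA : A.Finite) (hne : A.Nonempty) :
    {B : Set GaussianInt | IsHomotheticCopy A B ∧
      B ⊆ Set.range (insertBlocks n w a)}.Infinite := by
  obtain ⟨R, hR⟩ : ∃ R : ℤ, ∀ u ∈ A, supNorm u ≤ R := by
    obtain ⟨R, hR⟩ := (hA.image supNorm).bddAbove
    exact ⟨R, fun u hu => hR ⟨u, hu, rfl⟩⟩
  have hlim : Filter.Tendsto (fun k => √(ε * n k)) Filter.atTop Filter.atTop :=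
    Real.tendsto_sqrt_atTop.comp ((tendsto_natCast_atTop_atTop.comp
      hn.strictMono.tendsto_atTop).const_mul_atTop hε)
  obtain ⟨K, hK⟩ := Filter.eventually_atTop.1 (hlim.eventually_ge_atTop (2 * R + 1))
  -- Translates suffice (`m = 1`). The shift by `R` moves both coordinates of the points of `A` into
  -- `[0, 2R]`.
  let B : ℕ → Set GaussianInt := fun k =>
    (fun u => (⟨2 * 3 ^ n k + R, 2 * 3 ^ n k + R⟩ : GaussianInt) + 1 • u) '' A
  have hB : ∀ k, K ≤ k → B k ⊆ square ε (n k) := by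
    rintro k hk _ ⟨u, hu, rfl⟩
    have h1 := hR u hu
    simp only [supNorm] at h1
    have h2 := abs_le.1 ((le_max_left _ _).trans h1)
    have h3 := abs_le.1 ((le_max_right _ _).trans h1)
    refine ⟨⟨R + u.re, R + u.im⟩, by simp only; linarith, by simp only; linarith, ?_, ?_⟩
    · have h4 : supNorm ⟨R + u.re, R + u.im⟩ ≤ 2 * R := by
        simp only [supNorm]
        apply max_le <;> rw [abs_le] <;> constructor <;> linarith
      have h5 : ((supNorm ⟨R + u.re, R + u.im⟩ : ℤ) : ℝ) ≤ 2 * R := by exact_mod_cast h4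
      linarith [hK k hk]
    · apply Zsqrtd.ext <;> simp [add_assoc]
  refine Set.infinite_of_injective_forall_mem (f := fun k => B (k + K)) ?_ fun k => ?_
  · intro k l hkl
    replace hkl : B (k + K) = B (l + K) := hkl
    obtain ⟨u, hu⟩ := hne.image
      (fun u => (⟨2 * 3 ^ n (k + K) + R, 2 * 3 ^ n (k + K) + R⟩ : GaussianInt) + 1 • u)
    have h1 := square_bounds hε.le (hn.gap _) (hB _ (Nat.le_add_left _ _) hu)
    have h2 := square_bounds hε.le (hn.gap _) (hB _ (Nat.le_add_left _ _) (hkl ▸ hu : u ∈ B (l + K)))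
    -- The norm of a single common point determines its square, so different indices give different
    -- copies.
    have key : ∀ i j : ℕ, 2 * 3 ^ i ≤ supNorm u → supNorm u < 3 ^ (j + 1) → i ≤ j := fun i j hi hj => by
      by_contra hlt
      have h3 : (3 : ℤ) ^ (j + 1) ≤ 3 ^ i := pow_le_pow_right₀ (by norm_num) (by omega)
      have hp : (0 : ℤ) < 3 ^ i := by positivity
      omega
    have := hn.strictMono.injective (le_antisymm (key _ _ h1.1 h2.2) (key _ _ h2.1 h1.2))
    omega
  · exact ⟨⟨_, 1, le_rfl, rfl⟩,
      (hB _ (Nat.le_add_left _ _)).trans (square_subset_range hn hw _)⟩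

end Admissible

end Hurwitz

namespace Hurwitz

/-! ### The Hölder estimate for deleting the blocks -/

open Finset

theorem le_mul_norm_sub {x y : ℂ} (hx : x ∈ irrationals) (hy : y ∈ irrationals) {M : ℕ}
    (h : ∀ i < M, digits x i = digits y i) (hM : digits x M ≠ digits y M)
    (hx3 : 3 ≤ supNorm (digits x (M + 1))) (hy3 : 3 ≤ supNorm (digits y (M + 1))) {P Q : ℝ}
    (hP : ∏ i ∈ range M, (2 * (supNorm (digits x i) : ℝ) + 1) ≤ 3 ^ P)
    (hxQ : 2 * (supNorm (digits x M) : ℝ) + 1 ≤ 3 ^ Q)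
    (hyQ : 2 * (supNorm (digits y M) : ℝ) + 1 ≤ 3 ^ Q) :
    (3 : ℝ) ^ (-(2 * P + 2 * Q)) ≤ 5 * ‖x - y‖ := by
  have hpos : ∀ d : GaussianInt, (0 : ℝ) < 2 * (supNorm d : ℝ) + 1 := fun d => by
    rw [supNorm_cast]; positivity
  have h1 := le_norm_sub hx hy M h hM hx3 hy3
  have h2 : (3 : ℝ) ^ (-(2 * P + 2 * Q)) = (((3 : ℝ) ^ P)⁻¹) ^ 2 * (((3 : ℝ) ^ Q)⁻¹ * ((3 : ℝ) ^ Q)⁻¹) := by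
    rw [Real.rpow_neg (by norm_num), Real.rpow_add (by norm_num), two_mul, two_mul,
      Real.rpow_add (by norm_num), Real.rpow_add (by norm_num)]
    simp only [mul_inv]
    ring
  have h3 : (((3 : ℝ) ^ P)⁻¹) ^ 2 * (((3 : ℝ) ^ Q)⁻¹ * ((3 : ℝ) ^ Q)⁻¹) ≤
      (∏ i ∈ range M, (2 * (supNorm (digits x i) : ℝ) + 1)⁻¹) ^ 2 *
      ((2 * (supNorm (digits x M) : ℝ) + 1)⁻¹ * (2 * (supNorm (digits y M) : ℝ) + 1)⁻¹) := by
    rw [prod_inv_distrib]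
    have hp : 0 < ∏ i ∈ range M, (2 * (supNorm (digits x i) : ℝ) + 1) :=
      prod_pos fun i _ => hpos _
    have h4 := inv_anti₀ (hpos (digits x M)) hxQ
    have h5 := inv_anti₀ (hpos (digits y M)) hyQ
    have h6 := pow_le_pow_left₀ (inv_nonneg.2 (Real.rpow_nonneg (by norm_num) P)) (inv_anti₀ hp hP) 2
    have h7 : 0 ≤ ((3 : ℝ) ^ Q)⁻¹ := inv_nonneg.2 (Real.rpow_nonneg (by norm_num) Q)
    exact mul_le_mul h6 (mul_le_mul h4 h5 h7 (h7.trans h4)) (mul_nonneg h7 h7) (sq_nonneg _)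
  rw [h2]
  linarith

/-- Reduces a Hölder bound to comparing exponents; `C` absorbs their lower-order terms into the
constant. -/
theorem le_mul_rpow_of_exponents {X Y A B C D r : ℝ} (hr : 0 < r) (hD : 0 ≤ D) (hY : 0 ≤ Y)
    (hX : X ≤ 3 ^ (-A)) (hB : (3 : ℝ) ^ (-B) ≤ D * Y) (h : r * (B - C) ≤ A) :
    X ≤ (D * 3 ^ C) ^ r * Y ^ r := by
  calc X ≤ 3 ^ (-A) := hX
    _ ≤ (3 : ℝ) ^ ((C - B) * r) := Real.rpow_le_rpow_of_exponent_le (by norm_num) (by linarith)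
    _ = (3 ^ (-B) * 3 ^ C) ^ r := by
      rw [Real.rpow_mul (by norm_num), ← Real.rpow_add (by norm_num)]
      congr 2; ring
    _ ≤ (D * Y * 3 ^ C) ^ r := by gcongr
    _ = (D * 3 ^ C) ^ r * Y ^ r := by
      rw [← Real.mul_rpow (by positivity) hY]
      congr 1; ring

theorem isSeed_digits {y : ℂ} (hy : y ∈ seedSet) : IsSeed (digits y) := hy.2

theorem IsSeed.three_le {a : ℕ → GaussianInt} (ha : IsSeed a) (j : ℕ) : 3 ≤ supNorm (a j) :=
  le_trans (le_self_pow₀ (by norm_num) (by omega)) (ha j).1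

theorem norm_sub_le_of_seed {x y : ℂ} (hx : x ∈ seedSet) (hy : y ∈ seedSet) {N : ℕ}
    (h : ∀ i < N, digits x i = digits y i) : ‖x - y‖ ≤ 3 ^ (-((N : ℝ) ^ 2 - N)) := by
  have hb : ∀ {z : ℂ}, z ∈ seedSet → ∀ i, ‖hurwitzMap^[i] z‖ ≤ ((3 : ℝ) ^ i)⁻¹ := fun {z} hz i => by
    refine norm_iterate_le hz.1 i (by positivity) ?_
    have h1 : (3 : ℝ) ^ (i + 1) ≤ supNorm (digits z i) := by exact_mod_cast (hz.2 i).1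
    have h2 : (1 : ℝ) ≤ 3 ^ i := one_le_pow₀ (by norm_num)
    rw [pow_succ] at h1
    linarith
  have h1 : ∏ i ∈ range N, ‖hurwitzMap^[i] x‖ * ‖hurwitzMap^[i] y‖ ≤
      3 ^ (-((N : ℝ) ^ 2 - N)) := by
    clear h
    induction N with
    | zero => simp
    | succ N ih =>
      rw [prod_range_succ]
      have e : (3 : ℝ) ^ (-(((N + 1 : ℕ) : ℝ) ^ 2 - (N + 1 : ℕ))) =
          3 ^ (-((N : ℝ) ^ 2 - N)) * (((3 : ℝ) ^ N)⁻¹ * ((3 : ℝ) ^ N)⁻¹) := by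
        rw [← Real.rpow_natCast 3 N, ← Real.rpow_neg (by norm_num), ← Real.rpow_add (by norm_num),
          ← Real.rpow_add (by norm_num)]
        congr 1
        push_cast
        ring
      rw [e]
      have h1 := hb hx N
      have h2 := hb hy N
      gcongr
  have h2 : ‖hurwitzMap^[N] x - hurwitzMap^[N] y‖ ≤ 1 := by
    have h3 := norm_iterate_le_two_fifths hx.1 N ((isSeed_digits hx).three_le N)
    have h4 := norm_iterate_le_two_fifths hy.1 N ((isSeed_digits hy).three_le N)
    linarith [norm_sub_le (hurwitzMap^[N] x) (hurwitzMap^[N] y)]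
  rw [norm_sub_eq_prod hx.1 hy.1 N h]
  calc _ ≤ (3 : ℝ) ^ (-((N : ℝ) ^ 2 - N)) * 1 :=
        mul_le_mul h1 h2 (norm_nonneg _) (by positivity)
    _ = _ := mul_one _

theorem exists_first_ne {α : Type*} {a b : ℕ → α} (h : a ≠ b) :
    ∃ N, (∀ i < N, a i = b i) ∧ a N ≠ b N := by
  classical
  have hex := Function.ne_iff.1 h
  exact ⟨Nat.find hex, fun i hi => not_not.1 (Nat.find_min hex hi), Nat.find_spec hex⟩

section Admissible

variable {ε : ℝ} {n : ℕ → ℕ} {w : ℕ → List GaussianInt} {a : ℕ → GaussianInt}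

/-- A block at `j + 1 = n l` has at most `ε * n l` terms, and its weight `j + 3` is `n l + 2`. The
index `k` stays general so that the induction hypothesis can be used at `l` when the block of `n l`
is peeled off. -/
theorem sum_block_le (hε : 0 ≤ ε) (hn : IsAdmissible ε n) (hw : IsEnumeration ε n w) (N : ℕ) :
    ∀ k, N < n k → ∑ j ∈ range N, ((j : ℝ) + 3) * (block n w (j + 1)).length ≤
      ∑ j ∈ range k, ε * n j * (n j + 2) := by
  have hnn : ∀ j, 0 ≤ ε * n j * (n j + 2) := fun j => by positivity
  induction N with
  | zero => intro k _; simpa using sum_nonneg fun j _ => hnn j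
  | succ N ih =>
    intro k hk
    rw [sum_range_succ]
    by_cases h : ∃ l, n l = N + 1
    · obtain ⟨l, hl⟩ := h
      have hlk : l < k := hn.strictMono.lt_iff_lt.1 (hl ▸ hk)
      have h1 := ih l (by omega)
      have h2 := length_le_of_enumeration hε (hw l).1 (hw l).2
      have h3 : ∑ j ∈ range (l + 1), ε * n j * (n j + 2) ≤ ∑ j ∈ range k, ε * n j * (n j + 2) :=
        sum_le_sum_of_subset_of_nonneg (range_subset_range.2 hlk) fun j _ _ => hnn j
      rw [sum_range_succ] at h3
      rw [← hl, block_apply hn.strictMono hn.pos]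
      have h4 : (n l : ℝ) = N + 1 := by exact_mod_cast hl
      have h5 : ((N : ℝ) + 3) * (w l).length ≤ (N + 3) * (ε * n l) := by gcongr
      rw [h4] at h3 h5
      nlinarith
    · push Not at h
      rw [block_eq_nil h]
      simpa using ih k (by omega)

theorem sum_block_le_sq (hε : 0 ≤ ε) (hn : IsAdmissible ε n) (hw : IsEnumeration ε n w) (N : ℕ) :
    ∑ j ∈ range N, ((j : ℝ) + 3) * (block n w (j + 1)).length ≤ 2 * ε * (N : ℝ) ^ 2 := by
  classical
  -- For the least such `k`, the preceding position is at most `N`, so `sum_le` there gives the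
  -- bound.
  have hex : ∃ k, N < n k := ⟨N, lt_apply_of_strictMono hn.strictMono hn.pos N⟩
  have h1 := sum_block_le hε hn hw N (Nat.find hex) (Nat.find_spec hex)
  refine h1.trans ?_
  rcases h : Nat.find hex with _ | l
  · simp only [range_zero, sum_empty]; positivity
  · have h2 : n l ≤ N := not_lt.1 (Nat.find_min hex (by omega))
    refine (hn.sum_le l).trans ?_
    gcongr

theorem group_factor_le (hε : 0 ≤ ε) (hn : IsAdmissible ε n) (hw : IsEnumeration ε n w)
    (ha : IsSeed a) {j : ℕ} {u : GaussianInt} (hu : u ∈ a j :: block n w (j + 1)) :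
    2 * (supNorm u : ℝ) + 1 ≤ 3 ^ (j + 3) := by
  have h1 := (group_bounds hε hn hw ha hu).2
  have h2 : 2 * supNorm u + 1 ≤ 3 ^ (j + 3) := by
    have h3 : (3 : ℤ) ^ (j + 3) = 3 * 3 ^ (j + 2) := by ring
    have hp : (0 : ℤ) < 3 ^ (j + 2) := by positivity
    omega
  exact_mod_cast h2

theorem prod_map_le_pow {l : List GaussianInt} {c : ℝ}
    (h : ∀ u ∈ l, 2 * (supNorm u : ℝ) + 1 ≤ c) :
    (l.map fun u => 2 * (supNorm u : ℝ) + 1).prod ≤ c ^ l.length := by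
  have hpos : ∀ d : GaussianInt, (0 : ℝ) < 2 * (supNorm d : ℝ) + 1 := fun d => by
    rw [supNorm_cast]; positivity
  induction l with
  | nil => simp
  | cons v l ih =>
    rw [List.map_cons, List.prod_cons, List.length_cons, pow_succ']
    refine mul_le_mul (h v List.mem_cons_self) (ih fun u hu => h u (List.mem_cons_of_mem _ hu)) ?_
      ((hpos v).le.trans (h v List.mem_cons_self))
    refine List.prod_nonneg fun x hx => ?_
    obtain ⟨u, -, rfl⟩ := List.mem_map.1 hx
    exact (hpos u).le

theorem prod_insertPrefix_le (hε : 0 ≤ ε) (hn : IsAdmissible ε n) (hw : IsEnumeration ε n w)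
    (ha : IsSeed a) (N : ℕ) :
    ((insertPrefix n w a N).map fun u => 2 * (supNorm u : ℝ) + 1).prod ≤
      3 ^ (∑ j ∈ range N, (j + 3) * ((block n w (j + 1)).length + 1)) := by
  induction N with
  | zero => simp [insertPrefix]
  | succ N ih =>
    rw [insertPrefix_succ, List.map_append, List.prod_append, sum_range_succ, pow_add]
    refine mul_le_mul ih ?_ ?_ (by positivity)
    · rw [pow_mul]
      exact prod_map_le_pow fun u hu => group_factor_le hε hn hw ha hu
    · refine List.prod_nonneg fun x hx => ?_
      obtain ⟨u, -, rfl⟩ := List.mem_map.1 hx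
      rw [supNorm_cast]; positivity

theorem exponent_le (hε : 0 ≤ ε) (hn : IsAdmissible ε n) (hw : IsEnumeration ε n w) (N : ℕ) :
    ((∑ j ∈ range N, (j + 3) * ((block n w (j + 1)).length + 1) : ℕ) : ℝ) ≤
      ((N : ℝ) ^ 2 + 5 * N) / 2 + 2 * ε * (N : ℝ) ^ 2 := by
  have h1 := sum_block_le_sq hε hn hw N
  have h2 : ∑ j ∈ range N, ((j : ℝ) + 3) = ((N : ℝ) ^ 2 + 5 * N) / 2 := by
    clear h1
    induction N with
    | zero => simp
    | succ N ih => rw [sum_range_succ, ih]; push_cast; ring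
  push_cast
  simp only [mul_add, mul_one, sum_add_distrib] at h1 h2 ⊢
  linarith

theorem le_mul_norm_sub_of_insertBlocks (hε : 0 ≤ ε) (hn : IsAdmissible ε n)
    (hw : IsEnumeration ε n w) {b : ℕ → GaussianInt} (ha : IsSeed a) (hb : IsSeed b) {x y : ℂ}
    (hx : x ∈ irrationals) (hy : y ∈ irrationals) (hxa : digits x = insertBlocks n w a)
    (hyb : digits y = insertBlocks n w b) {N : ℕ} (h : ∀ i < N, a i = b i) (hN : a N ≠ b N) :
    (3 : ℝ) ^ (-((1 + 4 * ε) * (N : ℝ) ^ 2 + 7 * N + 6)) ≤ 5 * ‖x - y‖ := by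
  set M := (insertPrefix n w a N).length with hMdef
  have hMa : digits x M = a N := by rw [hxa, insertBlocks_length]
  have hMb : digits y M = b N := by rw [hyb, hMdef, length_insertPrefix a b, insertBlocks_length]
  have h3a : ∀ i, 3 ≤ supNorm (digits x i) := fun i => by
    rw [hxa]; exact three_le_supNorm_insertBlocks hε hn hw ha i
  have h3b : ∀ i, 3 ≤ supNorm (digits y i) := fun i => by
    rw [hyb]; exact three_le_supNorm_insertBlocks hε hn hw hb i
  have hfac : ∀ {c : ℕ → GaussianInt}, IsSeed c →
      2 * (supNorm (c N) : ℝ) + 1 ≤ 3 ^ ((N : ℝ) + 3) := fun hc => by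
    have := group_factor_le hε hn hw hc (j := N) List.mem_cons_self
    rw [← Real.rpow_natCast] at this
    push_cast at this
    exact this
  have key := le_mul_norm_sub hx hy (M := M)
    (P := ((N : ℝ) ^ 2 + 5 * N) / 2 + 2 * ε * (N : ℝ) ^ 2) (Q := N + 3)
    (fun i hi => by rw [hxa, hyb, insertBlocks_congr h hi]) (by rwa [hMa, hMb])
    (h3a _) (h3b _) ?_ (by rw [hMa]; exact hfac ha) (by rw [hMb]; exact hfac hb)
  · refine le_trans (le_of_eq ?_) key
    congr 1
    ring
  · rw [hxa, prod_insertBlocks a N fun u => 2 * (supNorm u : ℝ) + 1]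
    refine (prod_insertPrefix_le hε hn hw ha N).trans ?_
    rw [← Real.rpow_natCast]
    exact Real.rpow_le_rpow_of_exponent_le (by norm_num) (exponent_le hε hn hw N)

theorem exists_holder_bound (hε : 0 < ε) (hn : IsAdmissible ε n) (hw : IsEnumeration ε n w) :
    ∃ C : ℝ, 0 < C ∧ ∀ y₁ ∈ seedSet, ∀ y₂ ∈ seedSet, ∀ x₁ ∈ irrationals, ∀ x₂ ∈ irrationals,
      digits x₁ = insertBlocks n w (digits y₁) → digits x₂ = insertBlocks n w (digits y₂) →
      ‖y₁ - y₂‖ ≤ C * ‖x₁ - x₂‖ ^ (1 / (1 + 5 * ε)) := by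
  -- The exponents require `(8 + 5ε)N ≤ εN² + const`; completing the square gives this constant.
  refine ⟨(5 * 3 ^ (6 + (8 + 5 * ε) ^ 2 / (4 * ε))) ^ (1 / (1 + 5 * ε)), by positivity, ?_⟩
  intro y₁ hy₁ y₂ hy₂ x₁ hx₁ x₂ hx₂ h₁ h₂
  by_cases hd : digits y₁ = digits y₂
  · rw [eq_of_digits_eq hy₁.1 hy₂.1 hd (isSeed_digits hy₁).three_le, sub_self, norm_zero]
    positivity
  obtain ⟨N, hlt, hne⟩ := exists_first_ne hd
  refine le_mul_rpow_of_exponents (by positivity) (by norm_num) (norm_nonneg _)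
    (norm_sub_le_of_seed hy₁ hy₂ hlt)
    (le_mul_norm_sub_of_insertBlocks hε.le hn hw (isSeed_digits hy₁) (isSeed_digits hy₂) hx₁ hx₂
      h₁ h₂ hlt hne) ?_
  rw [one_div, inv_mul_le_iff₀ (by positivity)]
  have h1 : (8 + 5 * ε) * N ≤ ε * (N : ℝ) ^ 2 + (8 + 5 * ε) ^ 2 / (4 * ε) := by
    have h2 : ε * (N : ℝ) ^ 2 + (8 + 5 * ε) ^ 2 / (4 * ε) - (8 + 5 * ε) * N =
        (2 * ε * N - (8 + 5 * ε)) ^ 2 / (4 * ε) := by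
      field_simp
      ring
    have h3 : 0 ≤ (2 * ε * N - (8 + 5 * ε)) ^ 2 / (4 * ε) := by positivity
    linarith
  linarith

end Admissible

end Hurwitz

namespace Hurwitz

/-! ### Lower bound for the dimension of the seed set -/

open Set

/-- The hypothesis makes `h` injective on `s` with a Hölder inverse, and a Hölder map of exponent
`r` multiplies dimension by at most `1 / r`. -/
theorem mul_dimH_le_dimH_image {α β : Type*} [MetricSpace α] [MetricSpace β] [Nonempty α]
    {h : α → β} {s : Set α} {C r : ℝ} (hC : 0 ≤ C) (hr : 0 < r)
    (H : ∀ a ∈ s, ∀ b ∈ s, dist a b ≤ C * dist (h a) (h b) ^ r) :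
    ENNReal.ofReal r * dimH s ≤ dimH (h '' s) := by
  have hinj : InjOn h s := fun a ha b hb hab => by
    have := H a ha b hb
    rw [hab, dist_self, Real.zero_rpow hr.ne', mul_zero] at this
    exact dist_le_zero.1 this
  have hleft : LeftInvOn (Function.invFunOn h s) h s := hinj.leftInvOn_invFunOn
  have hh : HolderOnWith C.toNNReal r.toNNReal (Function.invFunOn h s) (h '' s) := by
    rintro _ ⟨a, ha, rfl⟩ _ ⟨b, hb, rfl⟩
    rw [hleft ha, hleft hb, edist_dist, edist_dist, Real.coe_toNNReal r hr.le,
      ENNReal.ofReal_rpow_of_nonneg dist_nonneg hr.le]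
    change _ ≤ ENNReal.ofReal C * _
    rw [← ENNReal.ofReal_mul hC]
    exact ENNReal.ofReal_le_ofReal (H a ha b hb)
  have h1 := hh.dimH_image_le (Real.toNNReal_pos.2 hr)
  rw [hleft.image_image] at h1
  have h2 := (ENNReal.le_div_iff_mul_le (Or.inl (by simpa using hr))
    (Or.inl ENNReal.coe_ne_top)).1 h1
  rwa [mul_comm] at h2

/-! ### A mixed radix expansion with radices `9, 9², 9³, …` -/

/-- The remainder after `j` digits. -/
noncomputable def remainder (r : ℝ) : ℕ → ℝ
  | 0 => r
  | j + 1 => Int.fract (9 ^ (j + 1) * remainder r j)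

/-- The `j`-th digit, which is less than `9ʲ⁺¹`. -/
noncomputable def radixDigit (r : ℝ) (j : ℕ) : ℕ := ⌊9 ^ (j + 1) * remainder r j⌋₊

/-- The seed sequence that encodes the expansion of `r`. -/
noncomputable def seedSeq (r : ℝ) (j : ℕ) : GaussianInt :=
  ⟨((3 ^ (j + 1) + radixDigit r j / 3 ^ (j + 1) : ℕ) : ℤ), ((radixDigit r j % 3 ^ (j + 1) : ℕ) : ℤ)⟩

theorem remainder_mem {r : ℝ} (hr : r ∈ Ico (0 : ℝ) 1) (j : ℕ) : remainder r j ∈ Ico (0 : ℝ) 1 := by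
  cases j with
  | zero => exact hr
  | succ j => exact ⟨Int.fract_nonneg _, Int.fract_lt_one _⟩

theorem radixDigit_lt {r : ℝ} (hr : r ∈ Ico (0 : ℝ) 1) (j : ℕ) : radixDigit r j < 9 ^ (j + 1) := by
  have h := remainder_mem hr j
  have hp : (0 : ℝ) < 9 ^ (j + 1) := by positivity
  rw [radixDigit, Nat.floor_lt (mul_nonneg hp.le h.1)]
  push_cast
  nlinarith [h.2]

theorem remainder_eq {r : ℝ} (hr : r ∈ Ico (0 : ℝ) 1) (j : ℕ) :
    9 ^ (j + 1) * remainder r j = radixDigit r j + remainder r (j + 1) := by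
  have h := remainder_mem hr j
  have hp : (0 : ℝ) ≤ 9 ^ (j + 1) * remainder r j := mul_nonneg (by positivity) h.1
  rw [radixDigit, natCast_floor_eq_intCast_floor hp, remainder, Int.floor_add_fract]

/-- Quotient and remainder by `3^(j+1)` are both below `3^(j+1)`, so the real part lies in the seed
range and dominates the imaginary part. -/
theorem isSeed_seedSeq {r : ℝ} (hr : r ∈ Ico (0 : ℝ) 1) : IsSeed (seedSeq r) := by
  intro j
  have h1 := radixDigit_lt hr j
  have h2 : radixDigit r j / 3 ^ (j + 1) < 3 ^ (j + 1) := by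
    apply Nat.div_lt_of_lt_mul
    rwa [← mul_pow]
  have h3 : radixDigit r j % 3 ^ (j + 1) < 3 ^ (j + 1) := Nat.mod_lt _ (by positivity)
  simp only [supNorm, seedSeq, Nat.abs_cast]
  have e : (3 : ℤ) ^ (j + 1) = ((3 ^ (j + 1) : ℕ) : ℤ) := by push_cast; rfl
  rw [e]
  generalize 3 ^ (j + 1) = t at *
  generalize radixDigit r j / t = u at *
  generalize radixDigit r j % t = v at *
  omega

theorem radixDigit_eq_of_seedSeq_eq {r s : ℝ} {j : ℕ} (h : seedSeq r j = seedSeq s j) :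
    radixDigit r j = radixDigit s j := by
  simp only [seedSeq, Zsqrtd.mk.injEq, Nat.cast_inj, Nat.add_left_cancel_iff] at h
  rw [← Nat.div_add_mod (radixDigit r j) (3 ^ (j + 1)), h.1, h.2, Nat.div_add_mod]

/-- The first `N` radices multiply to `9^(1 + ⋯ + N) = 3^(N² + N)`, and equal digits cancel, leaving
a difference of remainders. -/
theorem abs_sub_le_of_seedSeq {r s : ℝ} (hr : r ∈ Ico (0 : ℝ) 1) (hs : s ∈ Ico (0 : ℝ) 1) {N : ℕ}
    (h : ∀ i < N, seedSeq r i = seedSeq s i) : |r - s| ≤ ((3 : ℝ) ^ (N ^ 2 + N))⁻¹ := by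
  have key : (3 : ℝ) ^ (N ^ 2 + N) * |r - s| = |remainder r N - remainder s N| := by
    induction N with
    | zero => simp [remainder]
    | succ N ih =>
      have e : (3 : ℝ) ^ ((N + 1) ^ 2 + (N + 1)) = 9 ^ (N + 1) * 3 ^ (N ^ 2 + N) := by
        rw [show (9 : ℝ) = 3 ^ 2 by norm_num, ← pow_mul, ← pow_add]
        congr 1
        ring
      have hp : (0 : ℝ) < 9 ^ (N + 1) := by positivity
      rw [e, mul_assoc, ih fun i hi => h i (by omega), ← abs_of_pos hp, ← abs_mul, mul_sub,
        remainder_eq hr, remainder_eq hs,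
        radixDigit_eq_of_seedSeq_eq (h N (by omega)), add_sub_add_left_eq_sub]
  have h1 := remainder_mem hr N
  have h2 := remainder_mem hs N
  have h3 : |remainder r N - remainder s N| ≤ 1 :=
    abs_le.2 ⟨by linarith [h1.1, h2.2], by linarith [h1.2, h2.1]⟩
  rw [← one_div, le_div_iff₀ (by positivity), mul_comm, key]
  exact h3

theorem seedSeq_injOn {r s : ℝ} (hr : r ∈ Ico (0 : ℝ) 1) (hs : s ∈ Ico (0 : ℝ) 1)
    (h : seedSeq r = seedSeq s) : r = s := by
  have key : ∀ N : ℕ, |r - s| ≤ (1 / 3) ^ N := fun N => by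
    refine (abs_sub_le_of_seedSeq hr hs (N := N) fun i _ => congrFun h i).trans ?_
    rw [one_div, inv_pow]
    exact inv_anti₀ (by positivity) (pow_le_pow_right₀ (by norm_num) (Nat.le_add_left _ _))
  have h0 : |r - s| ≤ 0 := ge_of_tendsto'
    (tendsto_pow_atTop_nhds_zero_of_lt_one (by norm_num) (by norm_num)) key
  exact sub_eq_zero.1 (abs_nonpos_iff.1 h0)

theorem digits_value_seed {a : ℕ → GaussianInt} (ha : IsSeed a) : digits (value a) = a :=
  digits_value ha.three_le

theorem value_mem_seedSet {a : ℕ → GaussianInt} (ha : IsSeed a) : value a ∈ seedSet := by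
  refine ⟨value_mem_irrationals ha.three_le, ?_⟩
  rw [digits_value_seed ha]
  exact ha

theorem IsSeed.factor_le {a : ℕ → GaussianInt} (ha : IsSeed a) (j : ℕ) :
    2 * (supNorm (a j) : ℝ) + 1 ≤ 3 ^ ((j : ℝ) + 3) := by
  have h1 := (ha j).2
  have h2 : 2 * supNorm (a j) + 1 ≤ 3 ^ (j + 3) := by
    have h3 : (3 : ℤ) ^ (j + 3) = 9 * 3 ^ (j + 1) := by ring
    have hp : (0 : ℤ) < 3 ^ (j + 1) := by positivity
    omega
  have h3 : 2 * (supNorm (a j) : ℝ) + 1 ≤ 3 ^ (j + 3) := by exact_mod_cast h2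
  rw [← Real.rpow_natCast] at h3
  push_cast at h3
  exact h3

theorem IsSeed.prod_le {a : ℕ → GaussianInt} (ha : IsSeed a) (N : ℕ) :
    ∏ i ∈ Finset.range N, (2 * (supNorm (a i) : ℝ) + 1) ≤ 3 ^ (((N : ℝ) ^ 2 + 5 * N) / 2) := by
  induction N with
  | zero => simp
  | succ N ih =>
    rw [Finset.prod_range_succ]
    have e : (3 : ℝ) ^ ((((N + 1 : ℕ) : ℝ) ^ 2 + 5 * (N + 1 : ℕ)) / 2) =
        3 ^ (((N : ℝ) ^ 2 + 5 * N) / 2) * 3 ^ ((N : ℝ) + 3) := by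
      rw [← Real.rpow_add (by norm_num)]
      congr 1
      push_cast
      ring
    rw [e]
    exact mul_le_mul ih (ha.factor_le N) (by rw [supNorm_cast]; positivity) (by positivity)

theorem abs_sub_le_mul_rpow {p : ℝ} (hp : 0 < p) (hp1 : p < 1) :
    ∀ r ∈ Ico (0 : ℝ) 1, ∀ s ∈ Ico (0 : ℝ) 1, dist r s ≤
      (5 * 3 ^ (6 + 9 / (p * (1 - p)))) ^ p * dist (value (seedSeq r)) (value (seedSeq s)) ^ p := by
  intro r hr s hs
  have hq : 0 < 1 - p := by linarith
  by_cases hd : seedSeq r = seedSeq s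
  · rw [seedSeq_injOn hr hs hd, dist_self]
    positivity
  obtain ⟨N, hlt, hne⟩ := exists_first_ne hd
  have hr' := isSeed_seedSeq hr
  have hs' := isSeed_seedSeq hs
  have er := digits_value_seed hr'
  have es := digits_value_seed hs'
  have key := le_mul_norm_sub (value_mem_seedSet hr').1 (value_mem_seedSet hs').1 (M := N)
    (by rwa [er, es]) (by rwa [er, es]) (by rw [er]; exact hr'.three_le _)
    (by rw [es]; exact hs'.three_le _) (by rw [er]; exact hr'.prod_le N)
    (by rw [er]; exact hr'.factor_le N) (by rw [es]; exact hs'.factor_le N)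
  rw [Real.dist_eq, dist_eq_norm]
  refine le_mul_rpow_of_exponents (A := (N : ℝ) ^ 2 + N) hp (by norm_num) (norm_nonneg _) ?_ key ?_
  · refine (abs_sub_le_of_seedSeq hr hs hlt).trans_eq ?_
    rw [Real.rpow_neg (by norm_num), ← Real.rpow_natCast]
    push_cast
    rfl
  -- After `p N ≤ N`, what remains is `6N ≤ (1 - p)N² + 9 / (1 - p)`, a completed square.
  · have h1 : p * (9 / (p * (1 - p))) = 9 / (1 - p) := by field_simp
    have h2 : (1 - p) * (N : ℝ) ^ 2 - 6 * N + 9 / (1 - p) = ((1 - p) * N - 3) ^ 2 / (1 - p) := by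
      field_simp
      ring
    have h3 : 0 ≤ ((1 - p) * N - 3) ^ 2 / (1 - p) := by positivity
    have h4 : p * N ≤ N := mul_le_of_le_one_left (by positivity) hp1.le
    nlinarith

theorem one_le_dimH_seedSet : 1 ≤ dimH seedSet := by
  have hI : dimH (Ico (0 : ℝ) 1) = 1 := by
    rw [Real.dimH_of_nonempty_interior (by simp)]
    simp
  refine le_of_forall_lt fun c hc => ?_
  obtain ⟨p, hcp, hp1⟩ := ENNReal.lt_iff_exists_nnreal_btwn.1 hc
  have hp0 : 0 < p := by exact_mod_cast zero_le.trans_lt hcp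
  have hp1' : (p : ℝ) < 1 := by exact_mod_cast hp1
  have h := mul_dimH_le_dimH_image (s := Ico (0 : ℝ) 1) (h := fun r => value (seedSeq r))
    (by have : 0 < 1 - (p : ℝ) := by linarith
        positivity) (NNReal.coe_pos.2 hp0)
    (abs_sub_le_mul_rpow (NNReal.coe_pos.2 hp0) hp1')
  rw [hI, mul_one, ENNReal.ofReal_coe_nnreal] at h
  refine hcp.trans_le (h.trans (dimH_mono ?_))
  rintro _ ⟨r, hr, rfl⟩
  exact value_mem_seedSet (isSeed_seedSeq hr)

end Hurwitz

namespace Hurwitz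

/-! ### Admissible insertion positions -/

/-- With `√2 ≤ 3` both sides become powers of `3`. The `ε`-free part asks for `N² - 9N - 6 ≥ 0`,
which holds from `10` on. -/
theorem prod_ge_of_ten_le {ε : ℝ} (hε : 0 ≤ ε) {N : ℕ} (hN : 10 ≤ N) :
    (∏ j ∈ Finset.Icc 1 (N + 1), 1 / (√2 * 3 ^ (j + 1))) * (1 / (3 : ℝ) ^ (2 * ε * (N : ℝ) ^ 2))
      ≥ (∏ j ∈ Finset.Icc 1 N, 1 / (3 : ℝ) ^ (2 * (j - 1))) ^ (1 + 5 * ε) := by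
  have h1 : ∀ M : ℕ, ∏ j ∈ Finset.Icc 1 M, 1 / (3 : ℝ) ^ (2 * (j - 1)) =
      3 ^ (-((M : ℝ) ^ 2 - M)) := fun M => by
    induction M with
    | zero => simp
    | succ M ih =>
      rw [Finset.prod_Icc_succ_top (by omega), ih, one_div, Nat.add_sub_cancel,
        ← Real.rpow_natCast 3 (2 * M), ← Real.rpow_neg (by norm_num), ← Real.rpow_add (by norm_num)]
      congr 1
      push_cast
      ring
  have h2 : ∀ M : ℕ, (3 : ℝ) ^ (-(((M : ℝ) ^ 2 + 5 * M) / 2)) ≤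
      ∏ j ∈ Finset.Icc 1 M, 1 / (√2 * 3 ^ (j + 1)) := fun M => by
    induction M with
    | zero => simp
    | succ M ih =>
      have e : (3 : ℝ) ^ (-((((M + 1 : ℕ) : ℝ) ^ 2 + 5 * (M + 1 : ℕ)) / 2)) =
          3 ^ (-(((M : ℝ) ^ 2 + 5 * M) / 2)) * (1 / (3 * 3 ^ (M + 1 + 1))) := by
        rw [show (3 : ℝ) * 3 ^ (M + 1 + 1) = 3 ^ (M + 3) by ring, one_div,
          ← Real.rpow_natCast 3 (M + 3), ← Real.rpow_neg (by norm_num),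
          ← Real.rpow_add (by norm_num)]
        congr 1
        push_cast
        ring
      rw [Finset.prod_Icc_succ_top (by omega), e]
      have hs : √2 ≤ 3 := (Real.sqrt_le_left (by norm_num)).2 (by norm_num)
      gcongr
  have hN' : (10 : ℝ) ≤ N := by exact_mod_cast hN
  rw [h1, ← Real.rpow_mul (by norm_num), ge_iff_le]
  refine le_trans ?_ (mul_le_mul_of_nonneg_right (h2 (N + 1)) (by positivity))
  rw [one_div, ← Real.rpow_neg (by norm_num), ← Real.rpow_add (by norm_num)]
  refine Real.rpow_le_rpow_of_exponent_le (by norm_num) ?_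
  push_cast
  have h3 : 0 ≤ ε * (N * (3 * N - 5)) := mul_nonneg hε (mul_nonneg (by positivity) (by linarith))
  nlinarith

theorem exists_isAdmissible {ε : ℝ} (hε : 0 < ε) : ∃ n, IsAdmissible ε n := by
  obtain ⟨m, hm⟩ := exists_nat_ge (2 * ε)
  have hm' : ∀ k, (m + 10) ≤ (m + 10) * 3 ^ k := fun k =>
    Nat.le_mul_of_pos_right _ (by positivity)
  -- Starting above `2ε` gives `√(2εt) ≤ t < 3^t` for the gap, and starting at `10` or more serves
  -- the product. With ratio `3` the sum closes: `2t² + 3t(3t + 2) ≤ 2(3t)²`.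
  refine ⟨fun k => (m + 10) * 3 ^ k, fun k => by positivity, fun i j hij => ?_, fun k => ?_,
    fun k => ?_, fun N hN => prod_ge_of_ten_le hε.le (by simp at hN; omega)⟩
  · exact Nat.mul_lt_mul_of_pos_left (Nat.pow_lt_pow_right (by norm_num) hij) (by omega)
  · have h1 := hm' k
    generalize (m + 10) * 3 ^ k = t at *
    have ht : (m : ℝ) ≤ t := by exact_mod_cast (by omega : m ≤ t)
    have h2 : √(2 * ε * t) ≤ t := by
      rw [Real.sqrt_le_left (by positivity), sq]
      exact mul_le_mul_of_nonneg_right (hm.trans ht) (by positivity)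
    have h3 : (t : ℝ) < 3 ^ t := by exact_mod_cast Nat.lt_pow_self (by norm_num)
    rw [pow_succ]
    linarith
  · induction k with
    | zero =>
      simp only [zero_add, Finset.sum_range_one, pow_zero, mul_one]
      have h1 : (2 : ℝ) ≤ ((m + 10 : ℕ) : ℝ) := by exact_mod_cast (by omega : 2 ≤ m + 10)
      generalize ((m + 10 : ℕ) : ℝ) = t at *
      have : 0 ≤ ε * (t * (t - 2)) := mul_nonneg hε.le (mul_nonneg (by linarith) (by linarith))
      linarith
    | succ k ih =>
      rw [Finset.sum_range_succ]
      refine (add_le_add_left ih _).trans ?_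
      have h1 : (10 : ℝ) ≤ (((m + 10) * 3 ^ k : ℕ) : ℝ) := by
        exact_mod_cast (by have := hm' k; omega)
      have h2 : (((m + 10) * 3 ^ (k + 1) : ℕ) : ℝ) = 3 * (((m + 10) * 3 ^ k : ℕ) : ℝ) := by
        push_cast; ring
      rw [h2]
      generalize (((m + 10) * 3 ^ k : ℕ) : ℝ) = t at *
      have : 0 ≤ ε * (t * (7 * t - 6)) := mul_nonneg hε.le (mul_nonneg (by linarith) (by linarith))
      linarith

theorem exists_isEnumeration (ε : ℝ) (n : ℕ → ℕ) : ∃ w, IsEnumeration ε n w :=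
  ⟨fun k => (square_finite ε (n k)).toFinset.toList, fun k =>
    ⟨Finset.nodup_toList _, fun u => by simp⟩⟩

/-! ### The inserted points -/

section Inserted

variable {ε : ℝ} {n : ℕ → ℕ} {w : ℕ → List GaussianInt}

theorem existsUnique_inserted (hε : 0 ≤ ε) (hn : IsAdmissible ε n) (hw : IsEnumeration ε n w)
    {y : ℂ} (hy : y ∈ seedSet) :
    ∃! x : ℂ, x ∈ irrationals ∧ digits x = insertBlocks n w (digits y) := by
  have h3 := three_le_supNorm_insertBlocks hε hn hw (isSeed_digits hy)
  refine ⟨value (insertBlocks n w (digits y)), ⟨value_mem_irrationals h3, digits_value h3⟩, ?_⟩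
  rintro x ⟨hx, hd⟩
  exact eq_of_digits_eq hx (value_mem_irrationals h3) (hd.trans (digits_value h3).symm)
    fun i => hd ▸ h3 i

theorem insertedPoint_spec (hε : 0 ≤ ε) (hn : IsAdmissible ε n) (hw : IsEnumeration ε n w)
    {y : ℂ} (hy : y ∈ seedSet) : insertedPoint n w y ∈ irrationals ∧
      digits (insertedPoint n w y) = insertBlocks n w (digits y) :=
  Function.invFunOn_pos (existsUnique_inserted hε hn hw hy).exists

theorem insertedPoint_injOn (hε : 0 ≤ ε) (hn : IsAdmissible ε n) (hw : IsEnumeration ε n w) :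
    Set.InjOn (insertedPoint n w) seedSet := fun y hy z hz h => by
  refine eq_of_digits_eq hy.1 hz.1 (insertBlocks_injective (n := n) (w := w) ?_)
    (isSeed_digits hy).three_le
  rw [← (insertedPoint_spec hε hn hw hy).2, ← (insertedPoint_spec hε hn hw hz).2, h]

theorem deletionMap_insertedPoint (hε : 0 ≤ ε) (hn : IsAdmissible ε n) (hw : IsEnumeration ε n w)
    {y : ℂ} (hy : y ∈ seedSet) : deletionMap n w (insertedPoint n w y) = y :=
  (insertedPoint_injOn hε hn hw).leftInvOn_invFunOn hy

theorem modifiedSeedSet_subset_patternSet (hε : 0 < ε) (hn : IsAdmissible ε n)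
    (hw : IsEnumeration ε n w) : modifiedSeedSet n w ⊆ patternSet := by
  rintro _ ⟨y, hy, rfl⟩
  obtain ⟨h1, h2⟩ := insertedPoint_spec hε.le hn hw hy
  refine ⟨⟨h1, ?_⟩, fun A hA hne => ?_⟩
  · rw [h2]
    exact insertBlocks_seq_injective hε.le hn hw (isSeed_digits hy)
  · rw [h2]
    exact infinite_homothetic_copies hε hn hw hA hne

theorem le_dimH_modifiedSeedSet (hε : 0 < ε) (hn : IsAdmissible ε n) (hw : IsEnumeration ε n w) :
    ENNReal.ofReal (1 / (1 + 5 * ε)) ≤ dimH (modifiedSeedSet n w) := by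
  obtain ⟨C, hC, h⟩ := exists_holder_bound hε hn hw
  have key := mul_dimH_le_dimH_image (h := insertedPoint n w) (s := seedSet) hC.le
    (r := 1 / (1 + 5 * ε)) (by positivity) fun y hy z hz => by
      rw [dist_eq_norm, dist_eq_norm]
      exact h y hy z hz _ (insertedPoint_spec hε.le hn hw hy).1 _
        (insertedPoint_spec hε.le hn hw hz).1 (insertedPoint_spec hε.le hn hw hy).2
        (insertedPoint_spec hε.le hn hw hz).2
  exact le_trans (le_mul_of_one_le_right zero_le one_le_dimH_seedSet) key

end Inserted

end Hurwitz

theorem mainTheorem3 (ε : ℝ) (hε : 0 < ε) :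
    (∃ (n : ℕ → ℕ) (w : ℕ → List GaussianInt),
      Hurwitz.IsAdmissible ε n ∧ Hurwitz.IsEnumeration ε n w) ∧
    (∀ (n : ℕ → ℕ) (w : ℕ → List GaussianInt),
      Hurwitz.IsAdmissible ε n → Hurwitz.IsEnumeration ε n w →
        (∀ y ∈ Hurwitz.seedSet, ∃! x : ℂ, x ∈ Hurwitz.irrationals ∧
          Hurwitz.digits x = Hurwitz.insertBlocks n w (Hurwitz.digits y)) ∧
        Set.BijOn (Hurwitz.deletionMap n w) (Hurwitz.modifiedSeedSet n w) Hurwitz.seedSet ∧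
        (∀ x ∈ Hurwitz.modifiedSeedSet n w, x ∈ Hurwitz.irrationals ∧
          Hurwitz.digits x =
            Hurwitz.insertBlocks n w (Hurwitz.digits (Hurwitz.deletionMap n w x))) ∧
        (∃ C : ℝ, 0 < C ∧
          ∀ x₁ ∈ Hurwitz.modifiedSeedSet n w, ∀ x₂ ∈ Hurwitz.modifiedSeedSet n w,
            ‖Hurwitz.deletionMap n w x₁ - Hurwitz.deletionMap n w x₂‖
              ≤ C * ‖x₁ - x₂‖ ^ (1 / (1 + 5 * ε))) ∧
        Hurwitz.modifiedSeedSet n w ⊆ Hurwitz.patternSet ∧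
        ENNReal.ofReal (1 / (1 + 5 * ε)) ≤ dimH (Hurwitz.modifiedSeedSet n w)) ∧
    ENNReal.ofReal (1 / (1 + 5 * ε)) ≤ dimH Hurwitz.patternSet := by
  obtain ⟨n, hn⟩ := Hurwitz.exists_isAdmissible hε
  obtain ⟨w, hw⟩ := Hurwitz.exists_isEnumeration ε n
  refine ⟨⟨n, w, hn, hw⟩, fun n w hn hw => ⟨fun y hy =>
    Hurwitz.existsUnique_inserted hε.le hn hw hy, ?_, ?_, ?_,
    Hurwitz.modifiedSeedSet_subset_patternSet hε hn hw,
    Hurwitz.le_dimH_modifiedSeedSet hε hn hw⟩,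
    (Hurwitz.le_dimH_modifiedSeedSet hε hn hw).trans
      (dimH_mono (Hurwitz.modifiedSeedSet_subset_patternSet hε hn hw))⟩
  · have hdel := fun {y} hy => Hurwitz.deletionMap_insertedPoint hε.le hn hw (y := y) hy
    refine ⟨?_, ?_, fun y hy => ⟨_, ⟨y, hy, rfl⟩, hdel hy⟩⟩
    · rintro _ ⟨y, hy, rfl⟩
      rwa [hdel hy]
    · rintro _ ⟨y, hy, rfl⟩ _ ⟨z, hz, rfl⟩ h
      rw [hdel hy, hdel hz] at h
      rw [h]
  · rintro _ ⟨y, hy, rfl⟩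
    rw [Hurwitz.deletionMap_insertedPoint hε.le hn hw hy]
    exact Hurwitz.insertedPoint_spec hε.le hn hw hy
  · obtain ⟨C, hC, h⟩ := Hurwitz.exists_holder_bound hε hn hw
    refine ⟨C, hC, ?_⟩
    rintro _ ⟨y, hy, rfl⟩ _ ⟨z, hz, rfl⟩
    rw [Hurwitz.deletionMap_insertedPoint hε.le hn hw hy,
      Hurwitz.deletionMap_insertedPoint hε.le hn hw hz]
    exact h y hy z hz _ (Hurwitz.insertedPoint_spec hε.le hn hw hy).1 _
      (Hurwitz.insertedPoint_spec hε.le hn hw hz).1 (Hurwitz.insertedPoint_spec hε.le hn hw hy).2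
      (Hurwitz.insertedPoint_spec hε.le hn hw hz).2
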